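/- **Setting.** Let $M\ge 1$, $[M]=\{1,\dots,M\}$, and let $X_i(n)$, $i\in[M]$, $n\ge 1$, and $Z_i(n)$, $i\in[M]$, $n\ge 0$, be random elements on a measurable space $\Omega$, the $X_i(n)$ with values in a measurable space $\mathbb S$. For each $i$ let $\nu_i$ be a $\sigma$-finite measure on $\mathbb S$ and $f_{0i},f_{1i}$ two probability densities with respect to $\nu_i$. For each $A\subseteq[M]$ let $\mathsf P_A$ be a probability measure on $\Omega$, with expectation $\mathsf E_A$, under which all the $X_i(n)$ and $Z_i(n)$ are independent, each $Z_i(n)$ is uniform on $(0,1)$, and each $X_i(n)$ has density $f_{1i}$ if $i\in A$ and $f_{0i}$ if $i\notin A$. Assume that the Kullback--Leibler divergences $I_i=\int \log(f_{1i}/f_{0i})f_{1i}\,d\nu_i$ and $J_i=\int\log(f_{0i}/f_{1i})f_{0i}\,d\nu_i$ lie in $(0,\infty)$ for all $i$. **Policies.** For random sets $R(n)\subseteq[M]$, $n\ge1$, let $\mathcal F^R_0=\sigma(Z_i(0): i\in[M])$ and let $\mathcal F^R_n$ be generated by $\mathcal F^R_{n-1}$, the $Z_i(n)$, $i\in[M]$,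 and the observations $X_i(n)$, $i\in R(n)$. $R$ is a *sampling rule* if $R(n)$ is $\mathcal F^R_{n-1}$-measurable for every $n\ge1$. A *policy* is a triplet $(R,T,\Delta)$ where $R$ is a sampling rule, $T$ is an $(\mathcal F^R_n)$-stopping time with values in $\{1,2,\dots\}\cup\{\infty\}$, and $\Delta\subseteq[M]$ satisfies $\{T=n,\Delta=D\}\in\mathcal F_n^R$ for all $n\geq 1$, $D\subseteq[M]$. Put $\pi_i^R(n)=\frac1n\sum_{m=1}^n\mathbf 1\{i\in R(m)\}$. For $K\in(0,M]$, the triplet satisfies the *sampling constraint* if, $\mathsf P_B$-almost surely for every $B\subseteq[M]$, $\frac1T\sum_{m=1}^T|R(m)|\le K$ on $\{T<\infty\}$. For $k\in[M]$ and $\alpha\in(0,1)$, $\mathcal C(\alpha;k,K)$ is the class of policies that satisfy the sampling constraint and $\mathsf P_B(T<\infty,\ |B\triangle\Delta|\ge k)\le\alpha$ for every $B\subseteq[M]$, and $\mathcal J_A(\alpha;k,K)=\inf\{\mathsf E_A[T]:(R,T,\Delta)\in\mathcal C(\alpha;k,K)\}$. **Sum-intersection rule.** For a sampling rule $R$ let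 $\Lambda_i^R(n)=\sum_{m\le n,\ i\in R(m)}\log\frac{f_{1i}(X_i(m))}{f_{0i}(X_i(m))}$. For $d>0$ let $T^R_{si}$ be the first $n\ge1$ at which the sum of the $k$ smallest numbers among $|\Lambda_j^R(n)|$, $j\in[M]$, is at least $d$ ($\infty$ if there is none), and let $\Delta^R_{si}=\{i:\Lambda_i^R(T^R_{si})>0\}$. **Optimal allocation.** Let $F_1(A)\le\dots\le F_M(A)$ be the numbers $I_i$ ($i\in A$), $J_j$ ($j\notin A$) in increasing order, and let $(1),\dots,(M)$ be an enumeration of the sources in which source $(i)$ has the number $F_i(A)$. Let $$V(k,K,\boldsymbol F(A))=\max_{c}\ \min_{U\subseteq[M],\,|U|=k}\ \sum_{i\in U}c_iF_i(A),$$ the maximum being over all $c\in[0,1]^M$ with $\sum_i c_i\le K$. Let $c'$ be a maximizer with the smallest $\ell^1$ norm among all maximizers, and let $c^*_{(i)}(A)=c'_i$ for $i\in[M]$. **Theorem.** Fix $k\in[M]$, $K\in(0,M]$, $A\subseteq[M]$ and a sampling rule $R$, not depending on $\alpha$. Take the threshold $d=|\log\alpha|+\log\binom Mk$, and suppose that for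 all sufficiently small $\alpha\in(0,1)$ the triplet $(R,T^R_{si},\Delta^R_{si})$ satisfies the sampling constraint. Suppose further that $$\sum_{n=1}^\infty\mathsf P_A\bigl(\pi_i^R(n)<c_i^*(A)-\epsilon\bigr)<\infty\qquad\text{for every } i\in[M]\text{ and every }\epsilon>0 .$$ Then $(R,T^R_{si},\Delta^R_{si})\in\mathcal C(\alpha;k,K)$ for all sufficiently small $\alpha\in(0,1)$, and, as $\alpha\to0$, $$\mathsf E_A[T^R_{si}]\ \sim\ \mathcal J_A(\alpha;k,K)\ \sim\ \frac{|\log\alpha|}{V(k,K,\boldsymbol F(A))},$$ where $x\sim y$ means $x/y\to1$. -/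

import Mathlib

open MeasureTheory ProbabilityTheory Filter Topology
open scoped NNReal ENNReal

noncomputable section

namespace AnomalyID

/-! ### The max-min allocation problem -/

/-- The set `D(K)` of vectors in `[0,1]^M` whose coordinates add up to at most `K`. -/
def allocSet (M : ℕ) (K : ℝ) : Set (Fin M → ℝ) :=
  {c | (∀ i, 0 ≤ c i ∧ c i ≤ 1) ∧ ∑ i, c i ≤ K}

/-- The minimum of `∑_{i ∈ U} c_i L_i` over the subsets `U` of size `κ`
(a minimum over a finite set, non-empty when `κ ≤ M`). -/
def minSum {M : ℕ} (κ : ℕ) (L c : Fin M → ℝ) : ℝ :=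
  ⨅ U : {U : Finset (Fin M) // U.card = κ}, ∑ i ∈ U.1, c i * L i

/-- The value `V(κ, K, L)` of the max-min problem. -/
def optValue {M : ℕ} (κ : ℕ) (K : ℝ) (L : Fin M → ℝ) : ℝ :=
  sSup (minSum κ L '' allocSet M K)

/-- `c` attains the maximum of `minSum κ L` over `D(K)`. -/
def IsMaximizer {M : ℕ} (κ : ℕ) (K : ℝ) (L c : Fin M → ℝ) : Prop :=
  c ∈ allocSet M K ∧ ∀ b ∈ allocSet M K, minSum κ L b ≤ minSum κ L c

/-- `c` is a maximizer of least `ℓ¹` norm among all the maximizers. -/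
def IsMinNormMaximizer {M : ℕ} (κ : ℕ) (K : ℝ) (L c : Fin M → ℝ) : Prop :=
  IsMaximizer κ K L c ∧ ∀ b, IsMaximizer κ K L b → ∑ i, |c i| ≤ ∑ i, |b i|

/-! ### The statistical model -/

/-- The probability distribution with density `f` with respect to `ν`. -/
def lawOf {S : Type*} [MeasurableSpace S] (ν : Measure S) (f : S → ℝ≥0) : Measure S :=
  ν.withDensity fun x => (f x : ℝ≥0∞)

/-- `M` independent data sources with iid observations `X i n` (`n ≥ 1`), independent
randomization variables `Z i n` (`n ≥ 0`) uniform on `(0,1)`, and for every subset `A` of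
sources the probability measure `P A` under which exactly the sources in `A` are anomalous,
i.e. have density `f₁`. The variable `X i 0` is never used and is left unconstrained. -/
structure Model (M : ℕ) (S Ω : Type*) [MeasurableSpace S] [MeasurableSpace Ω] where
  ν : Fin M → Measure S
  f₀ : Fin M → S → ℝ≥0
  f₁ : Fin M → S → ℝ≥0
  X : Fin M → ℕ → Ω → S
  Z : Fin M → ℕ → Ω → ℝ
  P : Finset (Fin M) → Measure Ω
  sigmaFinite : ∀ i, SigmaFinite (ν i)
  measurable_f₀ : ∀ i, Measurable (f₀ i)
  measurable_f₁ : ∀ i, Measurable (f₁ i)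
  measurable_X : ∀ i n, Measurable (X i (n + 1))
  measurable_Z : ∀ i n, Measurable (Z i n)
  isProbabilityMeasure : ∀ A, IsProbabilityMeasure (P A)
  law_X : ∀ A i n, (P A).map (X i (n + 1)) = lawOf (ν i) (if i ∈ A then f₁ i else f₀ i)
  law_Z : ∀ A i n, (P A).map (Z i n) = volume.restrict (Set.Ioo (0 : ℝ) 1)
  indep : ∀ A, iIndep
    (Sum.elim
      (fun p : Fin M × ℕ => MeasurableSpace.comap (X p.1 (p.2 + 1)) inferInstance)
      (fun p : Fin M × ℕ => MeasurableSpace.comap (Z p.1 p.2) inferInstance)) (P A)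
  /-- The two Kullback-Leibler divergences of each source are positive and finite. -/
  kl_pos₁ : ∀ i, InformationTheory.klDiv (lawOf (ν i) (f₁ i)) (lawOf (ν i) (f₀ i)) ≠ 0
  kl_fin₁ : ∀ i, InformationTheory.klDiv (lawOf (ν i) (f₁ i)) (lawOf (ν i) (f₀ i)) ≠ ⊤
  kl_pos₀ : ∀ i, InformationTheory.klDiv (lawOf (ν i) (f₀ i)) (lawOf (ν i) (f₁ i)) ≠ 0
  kl_fin₀ : ∀ i, InformationTheory.klDiv (lawOf (ν i) (f₀ i)) (lawOf (ν i) (f₁ i)) ≠ ⊤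

/-- A sampling rule (set sampled at each time `n ≥ 1`; the value at `0` is never used),
a stopping time with values in `{1, 2, …, ∞}`, and a decision (meaningful once stopped). -/
structure Triplet (M : ℕ) (Ω : Type*) where
  R : ℕ → Ω → Finset (Fin M)
  T : Ω → ℕ∞
  Δ : Ω → Finset (Fin M)

/-- The proportion `π_i^R(n)` of times source `i` is sampled among the first `n` instants. -/
def freq {M : ℕ} {Ω : Type*} (R : ℕ → Ω → Finset (Fin M)) (i : Fin M) (n : ℕ) (ω : Ω) : ℝ :=
  (∑ m ∈ Finset.Icc 1 n, if i ∈ R m ω then (1 : ℝ) else 0) / n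

namespace Model

variable {M : ℕ} {S Ω : Type*} [MeasurableSpace S] [MeasurableSpace Ω] (𝓜 : Model M S Ω)

/-- `I_i`, the Kullback-Leibler divergence of `f₁` from `f₀`. -/
def I (i : Fin M) : ℝ :=
  (InformationTheory.klDiv (lawOf (𝓜.ν i) (𝓜.f₁ i)) (lawOf (𝓜.ν i) (𝓜.f₀ i))).toReal

/-- `J_i`, the Kullback-Leibler divergence of `f₀` from `f₁`. -/
def J (i : Fin M) : ℝ :=
  (InformationTheory.klDiv (lawOf (𝓜.ν i) (𝓜.f₀ i)) (lawOf (𝓜.ν i) (𝓜.f₁ i))).toReal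

/-- The information number of source `i` under `P A`: `I_i` if `i ∈ A`, else `J_i`. -/
def info (A : Finset (Fin M)) (i : Fin M) : ℝ := if i ∈ A then 𝓜.I i else 𝓜.J i

/-- `F(A)`: the numbers `info A i` in increasing order. -/
def F (A : Finset (Fin M)) : Fin M → ℝ := 𝓜.info A ∘ Tuple.sort (𝓜.info A)

/-- The `σ`-algebra `F_n^R` of the data collected up to time `n`. Since the set `R (n+1)` is
random, the observations at time `n + 1` contribute the events
`{i ∈ R (n+1), X_i (n+1) ∈ B}`. -/
@[reducible] def filt (R : ℕ → Ω → Finset (Fin M)) : ℕ → MeasurableSpace Ω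
  | 0 => ⨆ i, MeasurableSpace.comap (𝓜.Z i 0) inferInstance
  | n + 1 => filt R n ⊔ (⨆ i, MeasurableSpace.comap (𝓜.Z i (n + 1)) inferInstance) ⊔
      ⨆ i, MeasurableSpace.generateFrom
        {E | ∃ B : Set S, MeasurableSet B ∧ E = {ω | i ∈ R (n + 1) ω ∧ 𝓜.X i (n + 1) ω ∈ B}}

/-- `R (n+1)` is determined by the data collected up to time `n`. -/
def IsSamplingRule (R : ℕ → Ω → Finset (Fin M)) : Prop :=
  ∀ (n : ℕ) (D : Finset (Fin M)), MeasurableSet[𝓜.filt R n] {ω | R (n + 1) ω = D}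

/-- A sampling rule, a stopping time `T ≥ 1` (possibly infinite) of the induced filtration,
and a decision that is measurable at the time of stopping. -/
def IsPolicy (p : Triplet M Ω) : Prop :=
  𝓜.IsSamplingRule p.R ∧
  (∀ ω, 1 ≤ p.T ω) ∧
  (∀ n : ℕ, 1 ≤ n → MeasurableSet[𝓜.filt p.R n] {ω | p.T ω = n}) ∧
  (∀ n : ℕ, 1 ≤ n → ∀ D : Finset (Fin M),
    MeasurableSet[𝓜.filt p.R n] {ω | p.T ω = n ∧ p.Δ ω = D})

/-- Upon stopping, the average number of observations per time instant is at most `K`. -/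
def SamplingConstraint (K : ℝ) (p : Triplet M Ω) : Prop :=
  ∀ A, ∀ᵐ ω ∂(𝓜.P A), ∀ n : ℕ, p.T ω = n →
    (∑ m ∈ Finset.Icc 1 n, ((p.R m ω).card : ℝ)) / n ≤ K

/-- Whatever the set of anomalous sources, the probability of stopping and making at least `k`
errors is at most `α`. -/
def ErrorConstraint (α : ℝ) (k : ℕ) (p : Triplet M Ω) : Prop :=
  ∀ A, 𝓜.P A {ω | p.T ω ≠ ⊤ ∧ k ≤ (symmDiff A (p.Δ ω)).card} ≤ ENNReal.ofReal α

/-- The class `C(α; k, K)` of policies. -/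
def policyClass (α : ℝ) (k : ℕ) (K : ℝ) : Set (Triplet M Ω) :=
  {p | 𝓜.IsPolicy p ∧ 𝓜.SamplingConstraint K p ∧ 𝓜.ErrorConstraint α k p}

/-- `E_A[T]`, an extended non-negative real. -/
def expT (A : Finset (Fin M)) (T : Ω → ℕ∞) : ℝ≥0∞ := ∫⁻ ω, (T ω : ℝ≥0∞) ∂(𝓜.P A)

/-- `J_A(α; k, K)`: the infimum of `E_A[T]` over the class `C(α; k, K)`. -/
def optTime (A : Finset (Fin M)) (α : ℝ) (k : ℕ) (K : ℝ) : ℝ≥0∞ :=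
  ⨅ p ∈ 𝓜.policyClass α k K, 𝓜.expT A p.T

/-- The local log-likelihood ratio `Λ_i^R(n)`. -/
def llr (R : ℕ → Ω → Finset (Fin M)) (i : Fin M) (n : ℕ) (ω : Ω) : ℝ :=
  ∑ m ∈ Finset.Icc 1 n,
    if i ∈ R m ω then Real.log ((𝓜.f₁ i (𝓜.X i m ω) : ℝ) / (𝓜.f₀ i (𝓜.X i m ω) : ℝ)) else 0

/-- The absolute values of the log-likelihood ratios at time `n`, in increasing order. -/
def sortedAbsLLR (R : ℕ → Ω → Finset (Fin M)) (n : ℕ) (ω : Ω) : Fin M → ℝ :=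
  (fun j => |𝓜.llr R j n ω|) ∘ Tuple.sort (fun j => |𝓜.llr R j n ω|)

/-- First time `n ≥ 1` at which the sum of the `k` smallest absolute log-likelihood ratios
is at least `d` (infinite if there is none). -/
def siTime (R : ℕ → Ω → Finset (Fin M)) (k : ℕ) (d : ℝ) (ω : Ω) : ℕ∞ :=
  sInf ((fun n : ℕ => (n : ℕ∞)) ''
    {n : ℕ | 1 ≤ n ∧ d ≤ ∑ i : Fin M with i.val < k, 𝓜.sortedAbsLLR R n ω i})

/-- The sources whose log-likelihood ratio is positive upon stopping. -/
def siDecision (R : ℕ → Ω → Finset (Fin M)) (k : ℕ) (d : ℝ) (ω : Ω) : Finset (Fin M) :=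
  {i : Fin M | 0 < 𝓜.llr R i (𝓜.siTime R k d ω).toNat ω}

/-- The sum-intersection rule with sampling rule `R` and threshold `d`. -/
def siPolicy (R : ℕ → Ω → Finset (Fin M)) (k : ℕ) (d : ℝ) : Triplet M Ω where
  R := R
  T := 𝓜.siTime R k d
  Δ := 𝓜.siDecision R k d

end Model

/-- The threshold `|log α| + log (M choose k)`. -/
def threshold (M k : ℕ) (α : ℝ) : ℝ := |Real.log α| + Real.log (M.choose k : ℝ)

/-- `x(α) ∼ y(α)` as `α → 0`, `α > 0`. -/
def AsympEquiv (x y : ℝ → ℝ≥0∞) : Prop :=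
  Tendsto (fun α => x α / y α) (𝓝[>] 0) (𝓝 1)

end AnomalyID

end

/-!
Both expected times are sandwiched between `|log α| / V + O(1)` and `|log α| / V' + O(1)` for every
`V' < V`.

Lower bound: let a policy of the class and a set `U` of `k` sources be given, and let `W ⊆ U` be
the sources of `U` that the policy identifies correctly. Reversing the status of the sources in `W`
makes the policy wrong on all of `U`, which has probability at most `α`, while the cost of this
change of measure is `exp (-x)`, where `x` is the log-likelihood ratio of `P A` against the new
measure. Since `-log α ≤ x + exp (-x) / α`, Wald's identity yields that `|log α|` is at most
`∑ i ∈ U, E[N i] * info i` up to a constant, `N i` being the number of observations from source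
`i`. The vector `E[N i] / E[T]` is a feasible allocation, so minimizing over `U` gives `V * E[T]`.

Upper bound: if source `i` is sampled with frequency more than `c i - ε`, then `|Λ i| / n` is
eventually close to `c i * info i`, with exponentially small exceptional probabilities by Chernoff's
bound. As `c` is optimal, every sum of `k` of these numbers is then at least `V - ε`, so the
threshold `d` is crossed soon after time `d / V`.
-/

namespace AnomalyID

/-! ### Sums of the smallest values -/

theorem sum_initial_le_sum_of_monotone {M k : ℕ} {y : Fin M → ℝ} (hy : Monotone y)
    {V : Finset (Fin M)} (hV : V.card = k) :
    ∑ i : Fin M with i.val < k, y i ≤ ∑ i ∈ V, y i := by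
  have hkM : k ≤ M := by simpa [hV] using V.card_le_univ
  set L : Finset (Fin M) := {i | i.val < k} with hL
  have hcard : (L \ V).card = (V \ L).card :=
    Finset.card_sdiff_comm (by rw [hL, Fin.card_filter_val_lt, min_eq_right hkM, hV])
  have exchange : ∑ i ∈ L \ V, y i ≤ ∑ i ∈ V \ L, y i := by
    rcases (L \ V).eq_empty_or_nonempty with h | h
    · rw [h, Finset.card_empty] at hcard
      rw [h, Finset.card_eq_zero.1 hcard.symm]
    · obtain ⟨i₀, hi₀, hmax⟩ := Finset.exists_max_image (L \ V) y h
      have le_of_mem : ∀ j ∈ V \ L, i₀ ≤ j := by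
        simp only [hL, Finset.mem_sdiff, Finset.mem_filter_univ, not_lt] at hi₀ ⊢
        exact fun j hj => Fin.le_def.2 (hi₀.1.le.trans hj.2)
      calc ∑ i ∈ L \ V, y i ≤ (L \ V).card • y i₀ := Finset.sum_le_card_nsmul _ _ _ hmax
        _ = (V \ L).card • y i₀ := by rw [hcard]
        _ ≤ ∑ i ∈ V \ L, y i :=
          Finset.card_nsmul_le_sum _ _ _ fun j hj => hy (le_of_mem j hj)
  rw [← Finset.sum_inter_add_sum_sdiff L V, ← Finset.sum_inter_add_sum_sdiff V L,
    Finset.inter_comm V L]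
  gcongr

theorem sum_initial_sort_le {M k : ℕ} (x : Fin M → ℝ) {U : Finset (Fin M)} (hU : U.card = k) :
    ∑ i : Fin M with i.val < k, (x ∘ Tuple.sort x) i ≤ ∑ i ∈ U, x i := by
  simpa using sum_initial_le_sum_of_monotone (Tuple.monotone_sort x)
    (V := U.map (Tuple.sort x).symm.toEmbedding) (by simpa using hU)

theorem exists_sum_initial_sort_eq {M k : ℕ} (x : Fin M → ℝ) (hkM : k ≤ M) :
    ∃ U : Finset (Fin M), U.card = k ∧
      ∑ i : Fin M with i.val < k, (x ∘ Tuple.sort x) i = ∑ i ∈ U, x i := by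
  refine ⟨Finset.map (Tuple.sort x).toEmbedding {i | i.val < k}, ?_, ?_⟩
  · rw [Finset.card_map, Fin.card_filter_val_lt, min_eq_right hkM]
  · simp

theorem le_sum_initial_sort_iff {M k : ℕ} (x : Fin M → ℝ) (hkM : k ≤ M) (d : ℝ) :
    d ≤ ∑ i : Fin M with i.val < k, (x ∘ Tuple.sort x) i ↔
      ∀ U : Finset (Fin M), U.card = k → d ≤ ∑ i ∈ U, x i := by
  refine ⟨fun h U hU => h.trans (sum_initial_sort_le x hU), fun h => ?_⟩
  obtain ⟨U, hU, he⟩ := exists_sum_initial_sort_eq x hkM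
  exact he ▸ h U hU

/-! ### The allocation problem -/

section Allocation

variable {M k : ℕ} {K : ℝ} {L c : Fin M → ℝ}

theorem minSum_le (L c : Fin M → ℝ) {U : Finset (Fin M)} (hU : U.card = k) :
    minSum k L c ≤ ∑ i ∈ U, c i * L i :=
  ciInf_le (Set.finite_range _).bddBelow (⟨U, hU⟩ : {U : Finset (Fin M) // U.card = k})

theorem exists_minSum_eq (hkM : k ≤ M) (L c : Fin M → ℝ) :
    ∃ U : Finset (Fin M), U.card = k ∧ minSum k L c = ∑ i ∈ U, c i * L i := by
  obtain ⟨U₀, -, hU₀⟩ := Finset.exists_subset_card_eq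
    (s := (Finset.univ : Finset (Fin M))) (n := k) (by simpa using hkM)
  have : Nonempty {U : Finset (Fin M) // U.card = k} := ⟨⟨U₀, hU₀⟩⟩
  obtain ⟨U, hU⟩ := exists_eq_ciInf_of_finite
    (f := fun U : {U : Finset (Fin M) // U.card = k} => ∑ i ∈ U.1, c i * L i)
  exact ⟨U.1, U.2, hU.symm⟩

theorem bddAbove_minSum_image_allocSet (hkM : k ≤ M) (K : ℝ) (L : Fin M → ℝ) :
    BddAbove (minSum k L '' allocSet M K) := by
  refine ⟨∑ i, |L i|, ?_⟩
  rintro _ ⟨c, hc, rfl⟩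
  obtain ⟨U, -, hU⟩ := exists_minSum_eq hkM L c
  calc minSum k L c = ∑ i ∈ U, c i * L i := hU
    _ ≤ ∑ i ∈ U, |L i| := Finset.sum_le_sum fun i _ =>
        (mul_le_mul_of_nonneg_left (le_abs_self _) (hc.1 i).1).trans
          (mul_le_of_le_one_left (abs_nonneg _) (hc.1 i).2)
    _ ≤ ∑ i, |L i| :=
        Finset.sum_le_sum_of_subset_of_nonneg U.subset_univ fun i _ _ => abs_nonneg (L i)

theorem minSum_le_optValue (hkM : k ≤ M) (hc : c ∈ allocSet M K) :
    minSum k L c ≤ optValue k K L :=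
  le_csSup (bddAbove_minSum_image_allocSet hkM K L) ⟨c, hc, rfl⟩

theorem IsMaximizer.optValue_eq (h : IsMaximizer k K L c) : optValue k K L = minSum k L c :=
  IsGreatest.csSup_eq ⟨⟨c, h.1, rfl⟩, Set.forall_mem_image.2 h.2⟩

theorem optValue_pos (hk : 1 ≤ k) (hkM : k ≤ M) (hK : 0 < K) (hL : ∀ i, 0 < L i) :
    0 < optValue k K L := by
  have hM : (0 : ℝ) < M := by exact_mod_cast hk.trans hkM
  have hpos : 0 < min 1 (K / M) := lt_min one_pos (by positivity)
  have huniform : (fun _ : Fin M => min 1 (K / M)) ∈ allocSet M K := by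
    refine ⟨fun i => ⟨hpos.le, min_le_left _ _⟩, ?_⟩
    calc ∑ _i : Fin M, min 1 (K / M) = M * min 1 (K / M) := by simp
      _ ≤ M * (K / M) := by gcongr; exact min_le_right _ _
      _ = K := mul_div_cancel₀ _ hM.ne'
  obtain ⟨U, hU, he⟩ := exists_minSum_eq hkM L fun _ => min 1 (K / M)
  have hUne : U.Nonempty := Finset.card_pos.1 (by rw [hU]; exact hk)
  calc (0 : ℝ) < ∑ i ∈ U, min 1 (K / M) * L i :=
        Finset.sum_pos (fun i _ => mul_pos hpos (hL i)) hUne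
    _ = minSum k L fun _ => min 1 (K / M) := he.symm
    _ ≤ optValue k K L := minSum_le_optValue hkM huniform

theorem minSum_comp_perm (σ : Equiv.Perm (Fin M)) (L c : Fin M → ℝ) :
    minSum k (L ∘ σ) (c ∘ σ) = minSum k L c :=
  (σ.finsetCongr.subtypeEquiv fun U => by simp).iInf_congr fun U => by simp

theorem comp_perm_mem_allocSet_iff (σ : Equiv.Perm (Fin M)) :
    c ∘ σ ∈ allocSet M K ↔ c ∈ allocSet M K :=
  and_congr (σ.forall_congr_left.trans (by simp)) (by simp [Equiv.sum_comp σ c])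

theorem optValue_comp_perm (σ : Equiv.Perm (Fin M)) (L : Fin M → ℝ) :
    optValue k K (L ∘ σ) = optValue k K L := by
  refine congrArg sSup (Set.ext fun v => ?_)
  refine (σ.injective.surjective_comp_right (γ := ℝ)).exists.trans (exists_congr fun b => ?_)
  rw [comp_perm_mem_allocSet_iff, minSum_comp_perm]

theorem isMaximizer_comp_perm_iff (σ : Equiv.Perm (Fin M)) :
    IsMaximizer k K (L ∘ σ) (c ∘ σ) ↔ IsMaximizer k K L c := by
  refine and_congr (comp_perm_mem_allocSet_iff σ) ?_
  refine (σ.injective.surjective_comp_right (γ := ℝ)).forall.trans (forall_congr' fun b => ?_)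
  rw [comp_perm_mem_allocSet_iff, minSum_comp_perm, minSum_comp_perm]

end Allocation

/-! ### Log-likelihood ratios and exponential moments -/

section Densities

variable {S : Type*} [MeasurableSpace S]

theorem withDensity_exp_neg_llr {μ ν : Measure S} [SigmaFinite μ] [SigmaFinite ν] (hμν : μ ≪ ν)
    (hνμ : ν ≪ μ) :
    μ.withDensity (fun x => ENNReal.ofReal (Real.exp (-MeasureTheory.llr μ ν x))) = ν := by
  rw [← Measure.withDensity_rnDeriv_eq ν μ hνμ]
  apply withDensity_congr_ae
  rw [Measure.withDensity_rnDeriv_eq ν μ hνμ]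
  filter_upwards [exp_neg_llr hμν, ν.rnDeriv_lt_top μ] with x hexp hfin
  rw [hexp, ENNReal.ofReal_toReal hfin.ne]

variable {ν : Measure S} {f g : S → ℝ≥0}

theorem lawOf_eq_withDensity_div (hf : Measurable f) (hg : Measurable g)
    (hfg : lawOf ν f ≪ lawOf ν g) :
    lawOf ν f = (lawOf ν g).withDensity ((fun x => (f x : ℝ≥0∞)) / fun x => (g x : ℝ≥0∞)) := by
  have null : lawOf ν f {x | g x = 0} = 0 := hfg <| by
    rw [lawOf, withDensity_apply_eq_zero hg.coe_nnreal_ennreal]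
    simp [← Set.ofPred_and]
  rw [lawOf, withDensity_apply_eq_zero hf.coe_nnreal_ennreal] at null
  rw [lawOf, lawOf, ← withDensity_mul _ hg.coe_nnreal_ennreal
    (hf.coe_nnreal_ennreal.div hg.coe_nnreal_ennreal)]
  refine withDensity_congr_ae ((measure_eq_zero_iff_ae_notMem.1 null).mono fun x hx => ?_)
  by_cases hgx : g x = 0
  · have hfx : f x = 0 := by_contra fun h => hx ⟨by simpa using h, hgx⟩
    simp [hgx, hfx]
  · exact (ENNReal.mul_div_cancel (by simpa using hgx) ENNReal.coe_ne_top).symm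

variable [SigmaFinite ν]

theorem llr_lawOf_ae_eq (hf : Measurable f) (hg : Measurable g) (hfg : lawOf ν f ≪ lawOf ν g) :
    MeasureTheory.llr (lawOf ν f) (lawOf ν g) =ᵐ[lawOf ν f]
      fun x => Real.log ((f x : ℝ) / (g x : ℝ)) := by
  have : SigmaFinite (lawOf ν g) := SigmaFinite.withDensity g
  have h := (lawOf ν g).rnDeriv_withDensity (hf.coe_nnreal_ennreal.div hg.coe_nnreal_ennreal)
  rw [← lawOf_eq_withDensity_div hf hg hfg] at h
  filter_upwards [hfg.ae_le h] with x hx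
  simp [MeasureTheory.llr, hx, ENNReal.toReal_div]

theorem lawOf_withDensity_exp_neg_log (hf : Measurable f) (hg : Measurable g)
    (hfg : lawOf ν f ≪ lawOf ν g) (hgf : lawOf ν g ≪ lawOf ν f) :
    (lawOf ν f).withDensity
      (fun x => ENNReal.ofReal (Real.exp (-Real.log ((f x : ℝ) / (g x : ℝ))))) = lawOf ν g := by
  have : SigmaFinite (lawOf ν f) := SigmaFinite.withDensity f
  have : SigmaFinite (lawOf ν g) := SigmaFinite.withDensity g
  refine (withDensity_congr_ae ?_).trans (withDensity_exp_neg_llr hfg hgf)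
  exact (llr_lawOf_ae_eq hf hg hfg).mono fun x hx => by simp only [hx]

theorem integrable_log_div_lawOf (hf : Measurable f) (hg : Measurable g)
    (h : InformationTheory.klDiv (lawOf ν f) (lawOf ν g) ≠ ⊤) :
    Integrable (fun x => Real.log ((f x : ℝ) / (g x : ℝ))) (lawOf ν f) := by
  obtain ⟨hac, hint⟩ := InformationTheory.klDiv_ne_top_iff.1 h
  exact hint.congr (llr_lawOf_ae_eq hf hg hac)

theorem integral_log_div_lawOf (hf : Measurable f) (hg : Measurable g)
    [IsProbabilityMeasure (lawOf ν f)] [IsProbabilityMeasure (lawOf ν g)]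
    (hfg : lawOf ν f ≪ lawOf ν g) :
    ∫ x, Real.log ((f x : ℝ) / (g x : ℝ)) ∂(lawOf ν f) =
      (InformationTheory.klDiv (lawOf ν f) (lawOf ν g)).toReal := by
  rw [InformationTheory.toReal_klDiv_of_measure_eq hfg (by simp)]
  exact (integral_congr_ae (llr_lawOf_ae_eq hf hg hfg)).symm

end Densities

section ExponentialMoments

theorem le_exp_mul_sub_one_div {t : ℝ} (ht : 0 < t) (y : ℝ) :
    y ≤ (Real.exp (t * y) - 1) / t := by
  rw [le_div_iff₀ ht]
  linarith [Real.add_one_le_exp (t * y)]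

theorem exp_mul_sub_one_div_le {t : ℝ} (ht : 0 < t) (ht1 : t ≤ 1) (y : ℝ) :
    (Real.exp (t * y) - 1) / t ≤ Real.exp y - 1 := by
  have convexity : Real.exp (t * y) ≤ (1 - t) * 1 + t * Real.exp y := by
    simpa using convexOn_exp.2 (Set.mem_univ 0) (Set.mem_univ y) (sub_nonneg.2 ht1) ht.le (by ring)
  rw [div_le_iff₀ ht]
  linarith

theorem tendsto_exp_mul_sub_one_div (y : ℝ) :
    Tendsto (fun t : ℝ => (Real.exp (t * y) - 1) / t) (𝓝[>] 0) (𝓝 y) := by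
  have hderiv : HasDerivAt (fun t : ℝ => Real.exp (t * y)) y 0 := by
    simpa using ((hasDerivAt_id 0).mul_const y).exp
  simpa [div_eq_inv_mul] using hderiv.tendsto_slope_zero_right

variable {S : Type*} [MeasurableSpace S] {μ : Measure S} [IsProbabilityMeasure μ] {Y : S → ℝ}

theorem tendsto_mgf_sub_one_div (hY : Integrable Y μ)
    (hexp : Integrable (fun x => Real.exp (Y x)) μ) :
    Tendsto (fun t => (mgf Y μ t - 1) / t) (𝓝[>] 0) (𝓝 (∫ x, Y x ∂μ)) := by
  have hIoc : ∀ᶠ t : ℝ in 𝓝[>] 0, t ∈ Set.Ioc 0 1 := Ioc_mem_nhdsGT one_pos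
  have hint : ∀ t ∈ Set.Ioc (0 : ℝ) 1, Integrable (fun x => Real.exp (t * Y x)) μ := fun t ht =>
    integrable_exp_mul_of_nonneg_of_le (u := 1) (by simpa using hexp) ht.1.le ht.2
  have h : Tendsto (fun t => ∫ x, (Real.exp (t * Y x) - 1) / t ∂μ) (𝓝[>] 0)
      (𝓝 (∫ x, Y x ∂μ)) := by
    refine tendsto_integral_filter_of_dominated_convergence
      (fun x => |Y x| + |Real.exp (Y x) - 1|) ?_ ?_ ?_ ?_
    · filter_upwards [hIoc] with t ht
      exact (((hint t ht).sub (integrable_const 1)).div_const t).aestronglyMeasurable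
    · filter_upwards [hIoc] with t ht
      refine Eventually.of_forall fun x => ?_
      have lower := le_exp_mul_sub_one_div ht.1 (Y x)
      have upper := exp_mul_sub_one_div_le ht.1 ht.2 (Y x)
      rw [Real.norm_eq_abs, abs_le]
      constructor <;> linarith [neg_abs_le (Y x), abs_nonneg (Y x),
        le_abs_self (Real.exp (Y x) - 1), abs_nonneg (Real.exp (Y x) - 1)]
    · exact hY.abs.add (hexp.sub (integrable_const 1)).abs
    · exact Eventually.of_forall fun x => tendsto_exp_mul_sub_one_div (Y x)
  refine h.congr' (hIoc.mono fun t ht => ?_)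
  rw [integral_div, integral_sub (hint t ht) (integrable_const 1)]
  simp [mgf]

theorem exists_mgf_lt_one (hY : Integrable Y μ) (hexp : Integrable (fun x => Real.exp (Y x)) μ)
    (hneg : ∫ x, Y x ∂μ < 0) : ∃ t ∈ Set.Ioc (0 : ℝ) 1, mgf Y μ t < 1 := by
  obtain ⟨t, hlt, ht⟩ := (((tendsto_mgf_sub_one_div hY hexp).eventually_lt_const hneg).and
    (Ioc_mem_nhdsGT one_pos)).exists
  exact ⟨t, ht, by simpa [div_neg_iff, ht.1, ht.1.not_gt] using hlt⟩

end ExponentialMoments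

namespace Model

variable {M : ℕ} {S Ω : Type*} [MeasurableSpace S] [MeasurableSpace Ω] (𝓜 : Model M S Ω)

instance (i : Fin M) : SigmaFinite (𝓜.ν i) := 𝓜.sigmaFinite i

instance (A : Finset (Fin M)) : IsProbabilityMeasure (𝓜.P A) := 𝓜.isProbabilityMeasure A

/-- The law of the observations of source `i` under `P A`. -/
noncomputable def law (A : Finset (Fin M)) (i : Fin M) : Measure S :=
  lawOf (𝓜.ν i) (if i ∈ A then 𝓜.f₁ i else 𝓜.f₀ i)

/-- The log-likelihood ratio carried by one observation `x` of source `i`, of the hypothesis on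
this source which is true under `P A` against the other one. -/
noncomputable def score (A : Finset (Fin M)) (i : Fin M) (x : S) : ℝ :=
  if i ∈ A then Real.log ((𝓜.f₁ i x : ℝ) / (𝓜.f₀ i x : ℝ))
  else Real.log ((𝓜.f₀ i x : ℝ) / (𝓜.f₁ i x : ℝ))

theorem map_X (A : Finset (Fin M)) (i : Fin M) (n : ℕ) :
    (𝓜.P A).map (𝓜.X i (n + 1)) = 𝓜.law A i := 𝓜.law_X A i n

instance (A : Finset (Fin M)) (i : Fin M) : IsProbabilityMeasure (𝓜.law A i) :=
  𝓜.map_X A i 0 ▸ Measure.isProbabilityMeasure_map (𝓜.measurable_X i 0).aemeasurable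

instance (i : Fin M) : IsProbabilityMeasure (lawOf (𝓜.ν i) (𝓜.f₁ i)) := by
  simpa [law] using (inferInstance : IsProbabilityMeasure (𝓜.law Finset.univ i))

instance (i : Fin M) : IsProbabilityMeasure (lawOf (𝓜.ν i) (𝓜.f₀ i)) := by
  simpa [law] using (inferInstance : IsProbabilityMeasure (𝓜.law ∅ i))

theorem lawOf_f₁_absolutelyContinuous (i : Fin M) :
    lawOf (𝓜.ν i) (𝓜.f₁ i) ≪ lawOf (𝓜.ν i) (𝓜.f₀ i) :=
  (InformationTheory.klDiv_ne_top_iff.1 (𝓜.kl_fin₁ i)).1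

theorem lawOf_f₀_absolutelyContinuous (i : Fin M) :
    lawOf (𝓜.ν i) (𝓜.f₀ i) ≪ lawOf (𝓜.ν i) (𝓜.f₁ i) :=
  (InformationTheory.klDiv_ne_top_iff.1 (𝓜.kl_fin₀ i)).1

variable (A : Finset (Fin M)) (i : Fin M)

@[fun_prop]
theorem measurable_score : Measurable (𝓜.score A i) := by
  have h₁ := 𝓜.measurable_f₁ i
  have h₀ := 𝓜.measurable_f₀ i
  unfold score
  split_ifs <;> fun_prop

theorem law_withDensity_exp_neg_score {B : Finset (Fin M)} (h : i ∈ A ↔ i ∉ B) :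
    (𝓜.law A i).withDensity (fun x => ENNReal.ofReal (Real.exp (-𝓜.score A i x))) =
      𝓜.law B i := by
  by_cases hB : i ∈ B
  · simp only [law, score, h, hB, not_true, if_true, if_false]
    exact lawOf_withDensity_exp_neg_log (𝓜.measurable_f₀ i) (𝓜.measurable_f₁ i)
      (𝓜.lawOf_f₀_absolutelyContinuous i) (𝓜.lawOf_f₁_absolutelyContinuous i)
  · simp only [law, score, h, hB, not_false_iff, if_true, if_false]
    exact lawOf_withDensity_exp_neg_log (𝓜.measurable_f₁ i) (𝓜.measurable_f₀ i)
      (𝓜.lawOf_f₁_absolutelyContinuous i) (𝓜.lawOf_f₀_absolutelyContinuous i)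

theorem lintegral_exp_neg_score :
    ∫⁻ x, ENNReal.ofReal (Real.exp (-𝓜.score A i x)) ∂𝓜.law A i = 1 := by
  rw [← setLIntegral_univ, ← withDensity_apply _ MeasurableSet.univ,
    𝓜.law_withDensity_exp_neg_score A i (B := Aᶜ) (by simp), measure_univ]

theorem integrable_score : Integrable (𝓜.score A i) (𝓜.law A i) := by
  by_cases hA : i ∈ A
  · unfold law score
    simp only [hA, if_true]
    exact integrable_log_div_lawOf (𝓜.measurable_f₁ i) (𝓜.measurable_f₀ i) (𝓜.kl_fin₁ i)
  · unfold law score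
    simp only [hA, if_false]
    exact integrable_log_div_lawOf (𝓜.measurable_f₀ i) (𝓜.measurable_f₁ i) (𝓜.kl_fin₀ i)

theorem integral_score : ∫ x, 𝓜.score A i x ∂𝓜.law A i = 𝓜.info A i := by
  by_cases hA : i ∈ A
  · simp only [score, law, info, I, hA, if_true]
    exact integral_log_div_lawOf (𝓜.measurable_f₁ i) (𝓜.measurable_f₀ i)
      (𝓜.lawOf_f₁_absolutelyContinuous i)
  · simp only [score, law, info, J, hA, if_false]
    exact integral_log_div_lawOf (𝓜.measurable_f₀ i) (𝓜.measurable_f₁ i)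
      (𝓜.lawOf_f₀_absolutelyContinuous i)

theorem info_pos : 0 < 𝓜.info A i := by
  by_cases hA : i ∈ A
  · simpa only [info, I, hA, if_true] using ENNReal.toReal_pos (𝓜.kl_pos₁ i) (𝓜.kl_fin₁ i)
  · simpa only [info, J, hA, if_false] using ENNReal.toReal_pos (𝓜.kl_pos₀ i) (𝓜.kl_fin₀ i)

theorem exists_lintegral_exp_mul_sub_score_le_one {a : ℝ} (ha : a < 𝓜.info A i) :
    ∃ θ > 0, ∫⁻ x, ENNReal.ofReal (Real.exp (θ * (a - 𝓜.score A i x))) ∂𝓜.law A i ≤ 1 := by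
  have hexp : Integrable (fun x => Real.exp (-𝓜.score A i x)) (𝓜.law A i) :=
    (lintegral_ofReal_ne_top_iff_integrable (by fun_prop)
      (Eventually.of_forall fun x => (Real.exp_pos _).le)).1 (by simp [𝓜.lintegral_exp_neg_score])
  have hint := (integrable_const a).sub (𝓜.integrable_score A i)
  have hexp_sub : Integrable (fun x => Real.exp (a - 𝓜.score A i x)) (𝓜.law A i) := by
    simpa only [sub_eq_add_neg, Real.exp_add] using hexp.const_mul (Real.exp a)
  have hmean : ∫ x, (a - 𝓜.score A i x) ∂𝓜.law A i < 0 := by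
    rw [integral_sub (integrable_const a) (𝓜.integrable_score A i), 𝓜.integral_score]
    simpa using ha
  obtain ⟨θ, hθ, hlt⟩ := exists_mgf_lt_one hint hexp_sub hmean
  refine ⟨θ, hθ.1, ?_⟩
  rw [← ofReal_integral_eq_lintegral_ofReal (integrable_exp_mul_of_nonneg_of_le
    (u := 1) (by simpa using hexp_sub) hθ.1.le hθ.2)
    (Eventually.of_forall fun x => (Real.exp_pos _).le)]
  exact ENNReal.ofReal_le_one.2 hlt.le

end Model

/-! ### Sums over the sampling times of a source -/

section SampledSum

variable {M : ℕ} {Ω : Type*} {R : ℕ → Ω → Finset (Fin M)} {i : Fin M} {f : ℕ → Ω → ℝ} {ω : Ω}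

/-- The sum of `f m` over the times `1 ≤ m ≤ n` at which source `i` is sampled. The counts and the
log-likelihood ratios of the sources are of this form. -/
noncomputable def sampledSum (R : ℕ → Ω → Finset (Fin M)) (i : Fin M) (f : ℕ → Ω → ℝ) (n : ℕ)
    (ω : Ω) : ℝ :=
  ∑ m ∈ Finset.Icc 1 n, if i ∈ R m ω then f m ω else 0

/-- The number of times source `i` is sampled up to time `n`. -/
noncomputable def count (R : ℕ → Ω → Finset (Fin M)) (i : Fin M) : ℕ → Ω → ℝ :=
  sampledSum R i fun _ _ => 1

/-- The sampling rule `R` switched off after the time `T`. -/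
def stopped (R : ℕ → Ω → Finset (Fin M)) (T : Ω → ℕ∞) (m : ℕ) (ω : Ω) : Finset (Fin M) :=
  if (m : ℕ∞) ≤ T ω then R m ω else ∅

theorem sampledSum_zero : sampledSum R i f 0 ω = 0 := by simp [sampledSum]

theorem sampledSum_succ (n : ℕ) :
    sampledSum R i f (n + 1) ω =
      sampledSum R i f n ω + if i ∈ R (n + 1) ω then f (n + 1) ω else 0 := by
  rw [sampledSum, Finset.sum_Icc_succ_top (by lia), sampledSum]

theorem measurable_sampledSum {m₀ : MeasurableSpace Ω} {n : ℕ}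
    (h : ∀ m < n, Measurable fun ω => if i ∈ R (m + 1) ω then f (m + 1) ω else 0) :
    Measurable (sampledSum R i f n) := by
  refine Finset.measurable_sum _ fun m hm => ?_
  obtain ⟨h1, hn⟩ := Finset.mem_Icc.1 hm
  obtain ⟨j, rfl⟩ := Nat.exists_eq_add_of_le' h1
  exact h j hn

theorem sampledSum_stopped {T : Ω → ℕ∞} {n : ℕ} (hT : T ω = n) (N : ℕ) :
    sampledSum (stopped R T) i f N ω = sampledSum R i f (min N n) ω := by
  have times : Finset.Icc 1 (min N n) = (Finset.Icc 1 N).filter (· ≤ n) := by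
    ext m
    simp only [Finset.mem_Icc, Finset.mem_filter]
    lia
  rw [sampledSum, sampledSum, times, Finset.sum_filter]
  refine Finset.sum_congr rfl fun m _ => ?_
  by_cases hm : m ≤ n <;> simp [stopped, hT, hm]

theorem freq_eq_count_div (n : ℕ) : freq R i n ω = count R i n ω / n := rfl

theorem count_nonneg (i : Fin M) (n : ℕ) (ω : Ω) : 0 ≤ count R i n ω := by
  simp only [count, sampledSum]
  exact Finset.sum_nonneg fun m _ => by split_ifs <;> norm_num

theorem count_mono (i : Fin M) (ω : Ω) : Monotone fun n => count R i n ω := by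
  intro m n h
  simp only [count, sampledSum]
  exact Finset.sum_le_sum_of_subset_of_nonneg (Finset.Icc_subset_Icc_right h)
    fun m _ _ => by split_ifs <;> norm_num

theorem count_le (i : Fin M) (n : ℕ) (ω : Ω) : count R i n ω ≤ n := by
  simp only [count, sampledSum]
  calc ∑ m ∈ Finset.Icc 1 n, (if i ∈ R m ω then (1 : ℝ) else 0) ≤ ∑ m ∈ Finset.Icc 1 n, 1 :=
        Finset.sum_le_sum fun m _ => by split_ifs <;> norm_num
    _ = n := by simp

theorem count_stopped_le {T : Ω → ℕ∞} {n : ℕ} (hT : T ω = n) (i : Fin M) (N : ℕ) :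
    count (stopped R T) i N ω ≤ count R i n ω :=
  (sampledSum_stopped hT N).trans_le (count_mono i ω (min_le_right N n))

theorem sum_count (n : ℕ) (ω : Ω) :
    ∑ i, count R i n ω = ∑ m ∈ Finset.Icc 1 n, ((R m ω).card : ℝ) := by
  simp only [count, sampledSum]
  rw [Finset.sum_comm]
  exact Finset.sum_congr rfl fun m _ => by simp

end SampledSum

namespace Model

/-! ### Independence of the past and of the next observations -/

section Independence

variable {M : ℕ} {S Ω : Type*} [MeasurableSpace S] [MeasurableSpace Ω] (𝓜 : Model M S Ω)

/-- The `σ`-algebra generated by a single variable, the indices being those of `Model.indep`: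
`Sum.inl (i, n)` stands for `X i (n + 1)` and `Sum.inr (i, n)` for `Z i n`. -/
@[reducible] def varSigma : (Fin M × ℕ) ⊕ (Fin M × ℕ) → MeasurableSpace Ω :=
  Sum.elim (fun p => MeasurableSpace.comap (𝓜.X p.1 (p.2 + 1)) inferInstance)
    (fun p => MeasurableSpace.comap (𝓜.Z p.1 p.2) inferInstance)

/-- The `σ`-algebra generated by the variables with indices in `s`. -/
@[reducible] def sigmaOf (s : Set ((Fin M × ℕ) ⊕ (Fin M × ℕ))) : MeasurableSpace Ω :=
  ⨆ q ∈ s, 𝓜.varSigma q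

/-- The indices of the variables that are realized up to time `n`. -/
def pastIdx (M n : ℕ) : Set ((Fin M × ℕ) ⊕ (Fin M × ℕ)) :=
  {q | Sum.elim (fun p => p.2 < n) (fun p => p.2 ≤ n) q}

/-- The `σ`-algebra generated by all the variables, observed or not, up to time `n`. -/
@[reducible] def past (n : ℕ) : MeasurableSpace Ω := 𝓜.sigmaOf (pastIdx M n)

/-- The vector of the randomization variables of time `n`. -/
def noise (n : ℕ) (ω : Ω) (i : Fin M) : ℝ := 𝓜.Z i n ω

theorem varSigma_le (q : (Fin M × ℕ) ⊕ (Fin M × ℕ)) : 𝓜.varSigma q ≤ ‹MeasurableSpace Ω› := by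
  rcases q with p | p
  · exact (𝓜.measurable_X p.1 p.2).comap_le
  · exact (𝓜.measurable_Z p.1 p.2).comap_le

theorem sigmaOf_le (s : Set ((Fin M × ℕ) ⊕ (Fin M × ℕ))) : 𝓜.sigmaOf s ≤ ‹MeasurableSpace Ω› :=
  iSup₂_le fun q _ => 𝓜.varSigma_le q

theorem past_le (n : ℕ) : 𝓜.past n ≤ ‹MeasurableSpace Ω› := 𝓜.sigmaOf_le _

theorem past_mono : Monotone 𝓜.past := fun _ _ hmn => biSup_mono fun q hq => by
  rcases q with p | p
  · exact lt_of_lt_of_le hq hmn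
  · exact le_trans hq hmn

variable {𝓜} in
theorem measurable_sigmaOf_X {s : Set ((Fin M × ℕ) ⊕ (Fin M × ℕ))} {i : Fin M} {n : ℕ}
    (h : Sum.inl (i, n) ∈ s) : Measurable[𝓜.sigmaOf s] (𝓜.X i (n + 1)) :=
  (comap_measurable _).mono (le_iSup₂_of_le (f := fun q _ => 𝓜.varSigma q) _ h le_rfl) le_rfl

variable {𝓜} in
theorem measurable_sigmaOf_Z {s : Set ((Fin M × ℕ) ⊕ (Fin M × ℕ))} {i : Fin M} {n : ℕ}
    (h : Sum.inr (i, n) ∈ s) : Measurable[𝓜.sigmaOf s] (𝓜.Z i n) :=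
  (comap_measurable _).mono (le_iSup₂_of_le (f := fun q _ => 𝓜.varSigma q) _ h le_rfl) le_rfl

variable {𝓜} in
theorem measurable_sigmaOf_noise {s : Set ((Fin M × ℕ) ⊕ (Fin M × ℕ))} {n : ℕ}
    (h : ∀ i, Sum.inr (i, n) ∈ s) : Measurable[𝓜.sigmaOf s] (𝓜.noise n) :=
  @measurable_pi_lambda _ _ _ (𝓜.sigmaOf s) _ _ fun i => measurable_sigmaOf_Z (h i)

theorem measurable_noise (n : ℕ) : Measurable (𝓜.noise n) :=
  measurable_pi_lambda _ fun i => 𝓜.measurable_Z i n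

theorem iSup_comap_Z (n : ℕ) :
    ⨆ i, MeasurableSpace.comap (𝓜.Z i n) inferInstance =
      MeasurableSpace.comap (𝓜.noise n) inferInstance := by
  simp only [MeasurableSpace.pi, MeasurableSpace.comap_iSup, MeasurableSpace.comap_comp]
  rfl

theorem map_noise (A : Finset (Fin M)) (n : ℕ) :
    (𝓜.P A).map (𝓜.noise n) = Measure.pi fun _ => volume.restrict (Set.Ioo (0 : ℝ) 1) := by
  have hinj : Function.Injective fun i : Fin M => (Sum.inr (i, n) : (Fin M × ℕ) ⊕ (Fin M × ℕ)) :=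
    fun i j h => by simpa using h
  have hind : iIndepFun (fun i => 𝓜.Z i n) (𝓜.P A) :=
    (iIndepFun_iff_iIndep _ _ _).2 (iIndep.precomp hinj (𝓜.indep A))
  unfold noise
  rw [(iIndepFun_iff_map_fun_eq_pi_map fun i => (𝓜.measurable_Z i n).aemeasurable).1 hind]
  simp only [𝓜.law_Z]

theorem lintegral_comp_X (A : Finset (Fin M)) (i : Fin M) (n : ℕ) {g : S → ℝ≥0∞}
    (hg : Measurable g) :
    ∫⁻ ω, g (𝓜.X i (n + 1) ω) ∂𝓜.P A = ∫⁻ x, g x ∂𝓜.law A i := by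
  rw [← 𝓜.map_X A i n, lintegral_map hg (𝓜.measurable_X i n)]

theorem lintegral_prod_comp_X (A : Finset (Fin M)) (n : ℕ) {g : Fin M → S → ℝ≥0∞}
    (hg : ∀ i, Measurable (g i)) :
    ∫⁻ ω, ∏ i, g i (𝓜.X i (n + 1) ω) ∂𝓜.P A = ∏ i, ∫⁻ x, g i x ∂𝓜.law A i := by
  have hinj : Function.Injective fun i : Fin M => (Sum.inl (i, n) : (Fin M × ℕ) ⊕ (Fin M × ℕ)) :=
    fun i j h => by simpa using h
  have hind : iIndepFun (fun i => 𝓜.X i (n + 1)) (𝓜.P A) :=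
    (iIndepFun_iff_iIndep _ _ _).2 (iIndep.precomp hinj (𝓜.indep A))
  have hprod := lintegral_prod_eq_prod_lintegral_of_indepFun Finset.univ _ (hind.comp g hg)
    fun i => (hg i).comp (𝓜.measurable_X i n)
  simpa only [Function.comp_apply, 𝓜.lintegral_comp_X A _ n (hg _)] using hprod

theorem lintegral_mul_of_disjoint (A : Finset (Fin M)) {s t : Set ((Fin M × ℕ) ⊕ (Fin M × ℕ))}
    (hst : Disjoint s t) {f g : Ω → ℝ≥0∞} (hf : Measurable[𝓜.sigmaOf s] f)
    (hg : Measurable[𝓜.sigmaOf t] g) :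
    ∫⁻ ω, f ω * g ω ∂𝓜.P A = (∫⁻ ω, f ω ∂𝓜.P A) * ∫⁻ ω, g ω ∂𝓜.P A :=
  lintegral_mul_eq_lintegral_mul_lintegral_of_independent_measurableSpace (𝓜.sigmaOf_le s)
    (𝓜.sigmaOf_le t) (indep_iSup_of_disjoint 𝓜.varSigma_le (𝓜.indep A) hst) hf hg

theorem lintegral_past_mul_next (A : Finset (Fin M)) (i : Fin M) (n : ℕ) {h : Ω → ℝ≥0∞}
    (hh : Measurable[𝓜.past n] h) {g : S → ℝ≥0∞} (hg : Measurable g) :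
    ∫⁻ ω, h ω * g (𝓜.X i (n + 1) ω) ∂𝓜.P A =
      (∫⁻ ω, h ω ∂𝓜.P A) * ∫⁻ x, g x ∂𝓜.law A i := by
  rw [← 𝓜.lintegral_comp_X A i n hg]
  exact 𝓜.lintegral_mul_of_disjoint A
    (Set.disjoint_singleton_right.2 (by simp [pastIdx] : Sum.inl (i, n) ∉ pastIdx M n)) hh
    (hg.comp (measurable_sigmaOf_X rfl))

theorem lintegral_past_mul_prod_next (A : Finset (Fin M)) (n : ℕ) {h : Ω → ℝ≥0∞}
    (hh : Measurable[𝓜.past n] h) {g : Fin M → S → ℝ≥0∞} (hg : ∀ i, Measurable (g i))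
    {φ : (Fin M → ℝ) → ℝ≥0∞} (hφ : Measurable φ) :
    ∫⁻ ω, h ω * (∏ i, g i (𝓜.X i (n + 1) ω)) * φ (𝓜.noise (n + 1) ω) ∂𝓜.P A =
      (∫⁻ ω, h ω ∂𝓜.P A) * (∏ i, ∫⁻ x, g i x ∂𝓜.law A i) *
        ∫⁻ z, φ z ∂Measure.pi fun _ => volume.restrict (Set.Ioo (0 : ℝ) 1) := by
  let nextX : Set ((Fin M × ℕ) ⊕ (Fin M × ℕ)) := Set.range fun i => Sum.inl (i, n)
  let nextZ : Set ((Fin M × ℕ) ⊕ (Fin M × ℕ)) := Set.range fun i => Sum.inr (i, n + 1)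
  have disjX : Disjoint (pastIdx M n) nextX :=
    Set.disjoint_right.2 (by rintro _ ⟨i, rfl⟩; simp [pastIdx])
  have disjZ : Disjoint (pastIdx M n ∪ nextX) nextZ :=
    Set.disjoint_right.2 (by rintro _ ⟨i, rfl⟩; simp [pastIdx, nextX])
  have hX {s} (hs : nextX ⊆ s) :
      Measurable[𝓜.sigmaOf s] fun ω => ∏ i, g i (𝓜.X i (n + 1) ω) :=
    Finset.univ.measurable_prod fun i _ => (hg i).comp (measurable_sigmaOf_X (hs ⟨i, rfl⟩))
  have hZ : Measurable[𝓜.sigmaOf nextZ] fun ω => φ (𝓜.noise (n + 1) ω) :=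
    hφ.comp (measurable_sigmaOf_noise fun i => ⟨i, rfl⟩)
  have hpastX : Measurable[𝓜.sigmaOf (pastIdx M n ∪ nextX)]
      fun ω => h ω * ∏ i, g i (𝓜.X i (n + 1) ω) :=
    (hh.mono (biSup_mono fun q hq => Or.inl hq) le_rfl).mul (hX Set.subset_union_right)
  rw [𝓜.lintegral_mul_of_disjoint A disjZ hpastX hZ,
    𝓜.lintegral_mul_of_disjoint A disjX hh (hX subset_rfl), 𝓜.lintegral_prod_comp_X A n hg,
    ← 𝓜.map_noise A (n + 1), lintegral_map hφ (𝓜.measurable_noise (n + 1))]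

end Independence

end Model

namespace Model

/-! ### The filtration of a sampling rule -/

section Filtration

variable {M : ℕ} {S Ω : Type*} [MeasurableSpace S] [MeasurableSpace Ω] {𝓜 : Model M S Ω}
  {R : ℕ → Ω → Finset (Fin M)}

theorem filt_mono (𝓜 : Model M S Ω) (R : ℕ → Ω → Finset (Fin M)) : Monotone (𝓜.filt R) :=
  monotone_nat_of_le_succ fun _ => le_sup_of_le_left le_sup_left

theorem measurableSet_filt_succ_observation (i : Fin M) (n : ℕ) {B : Set S}
    (hB : MeasurableSet B) :
    MeasurableSet[𝓜.filt R (n + 1)] {ω | i ∈ R (n + 1) ω ∧ 𝓜.X i (n + 1) ω ∈ B} := by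
  have hle : MeasurableSpace.generateFrom
      {E | ∃ B : Set S, MeasurableSet B ∧ E = {ω | i ∈ R (n + 1) ω ∧ 𝓜.X i (n + 1) ω ∈ B}} ≤
      𝓜.filt R (n + 1) := le_sup_of_le_right (le_iSup_of_le i le_rfl)
  exact hle _ (MeasurableSpace.measurableSet_generateFrom ⟨B, hB, rfl⟩)

theorem IsSamplingRule.measurableSet_setOf (hR : 𝓜.IsSamplingRule R) (n : ℕ)
    (p : Finset (Fin M) → Prop) : MeasurableSet[𝓜.filt R n] {ω | p (R (n + 1) ω)} := by
  have fibers : {ω | p (R (n + 1) ω)} = ⋃ D ∈ {D | p D}, {ω | R (n + 1) ω = D} := by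
    ext ω; simp
  rw [fibers]
  exact MeasurableSet.biUnion (Set.to_countable _) fun D _ => hR n D

theorem IsSamplingRule.filt_le_past (hR : 𝓜.IsSamplingRule R) (n : ℕ) :
    𝓜.filt R n ≤ 𝓜.past n := by
  have noise_le (m : ℕ) : ⨆ i, MeasurableSpace.comap (𝓜.Z i m) inferInstance ≤ 𝓜.past m :=
    iSup_le fun i => (measurable_sigmaOf_Z (by simp [pastIdx])).comap_le
  induction n with
  | zero => exact noise_le 0
  | succ n ih =>
    refine sup_le (sup_le (ih.trans (𝓜.past_mono n.le_succ)) (noise_le (n + 1)))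
      (iSup_le fun i => MeasurableSpace.generateFrom_le ?_)
    rintro _ ⟨B, hB, rfl⟩
    exact (𝓜.past_mono n.le_succ _ (ih _ (hR.measurableSet_setOf n fun D => i ∈ D))).inter
      (measurable_sigmaOf_X (by simp [pastIdx]) hB)

theorem IsSamplingRule.filt_le (hR : 𝓜.IsSamplingRule R) (n : ℕ) :
    𝓜.filt R n ≤ ‹MeasurableSpace Ω› := (hR.filt_le_past n).trans (𝓜.past_le n)

theorem IsSamplingRule.measurable_ite_sampled (hR : 𝓜.IsSamplingRule R) (i : Fin M) (n : ℕ)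
    {g : S → ℝ} (hg : Measurable g) :
    Measurable[𝓜.filt R (n + 1)]
      fun ω => if i ∈ R (n + 1) ω then g (𝓜.X i (n + 1) ω) else 0 := by
  intro B hB
  have sampled := measurableSet_filt_succ_observation (𝓜 := 𝓜) (R := R) i n (hg hB)
  have notSampled := filt_mono 𝓜 R n.le_succ _
    (hR.measurableSet_setOf n fun D => i ∉ D ∧ (0 : ℝ) ∈ B)
  convert sampled.union notSampled using 1
  ext ω
  by_cases h : i ∈ R (n + 1) ω <;> simp [h]

/-- A family of sets that generates `F_{n+1}^R`: an event of `F_n^R`, a constraint on the new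
randomization variables, and a constraint on each of the new observations. -/
def filtGen (𝓜 : Model M S Ω) (R : ℕ → Ω → Finset (Fin M)) (n : ℕ) : Set (Set Ω) :=
  {s | ∃ (E : Set Ω) (C : Set (Fin M → ℝ)) (B : Fin M → Set S), MeasurableSet[𝓜.filt R n] E ∧
    MeasurableSet C ∧ (∀ i, MeasurableSet (B i)) ∧
    s = {ω | ω ∈ E ∧ 𝓜.noise (n + 1) ω ∈ C ∧ ∀ i ∈ R (n + 1) ω, 𝓜.X i (n + 1) ω ∈ B i}}

theorem isPiSystem_filtGen (n : ℕ) : IsPiSystem (𝓜.filtGen R n) := by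
  rintro _ ⟨E, C, B, hE, hC, hB, rfl⟩ _ ⟨E', C', B', hE', hC', hB', rfl⟩ -
  refine ⟨E ∩ E', C ∩ C', fun i => B i ∩ B' i, hE.inter hE', hC.inter hC',
    fun i => (hB i).inter (hB' i), ?_⟩
  ext ω
  simp only [Set.mem_inter_iff, Set.mem_ofPred_eq, forall₂_and]
  tauto

theorem univ_mem_filtGen (n : ℕ) : Set.univ ∈ 𝓜.filtGen R n :=
  ⟨Set.univ, Set.univ, fun _ => Set.univ, MeasurableSet.univ, MeasurableSet.univ,
    fun _ => MeasurableSet.univ, by simp⟩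

theorem IsSamplingRule.filt_succ_le_generateFrom_filtGen (hR : 𝓜.IsSamplingRule R) (n : ℕ) :
    𝓜.filt R (n + 1) ≤ MeasurableSpace.generateFrom (𝓜.filtGen R n) := by
  refine sup_le (sup_le ?_ ?_) (iSup_le fun i => MeasurableSpace.generateFrom_le ?_)
  · exact fun E hE => MeasurableSpace.measurableSet_generateFrom
      ⟨E, Set.univ, fun _ => Set.univ, hE, MeasurableSet.univ, fun _ => MeasurableSet.univ,
        by simp⟩
  · rw [iSup_comap_Z]
    rintro _ ⟨C, hC, rfl⟩
    exact MeasurableSpace.measurableSet_generateFrom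
      ⟨Set.univ, C, fun _ => Set.univ, MeasurableSet.univ, hC, fun _ => MeasurableSet.univ,
        by ext ω; simp⟩
  · rintro _ ⟨B, hB, rfl⟩
    refine MeasurableSpace.measurableSet_generateFrom
      ⟨{ω | i ∈ R (n + 1) ω}, Set.univ, Function.update (fun _ => Set.univ) i B,
        hR.measurableSet_setOf n fun D => i ∈ D, MeasurableSet.univ,
        (Function.forall_update_iff _ fun _ s => MeasurableSet s).2
          ⟨hB, fun _ _ => MeasurableSet.univ⟩, ?_⟩
    ext ω
    have update_iff := Function.forall_update_iff (fun _ : Fin M => (Set.univ : Set S)) (a := i)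
      (b := B) fun j s => j ∈ R (n + 1) ω → 𝓜.X j (n + 1) ω ∈ s
    simp only [Set.mem_ofPred_eq, Set.mem_univ, true_and, update_iff]
    simp +contextual

theorem IsSamplingRule.measurableSet_of_mem_filtGen (hR : 𝓜.IsSamplingRule R) (n : ℕ) {s : Set Ω}
    (hs : s ∈ 𝓜.filtGen R n) : MeasurableSet s := by
  obtain ⟨E, C, B, hE, hC, hB, rfl⟩ := hs
  have observations : MeasurableSet {ω | ∀ i ∈ R (n + 1) ω, 𝓜.X i (n + 1) ω ∈ B i} := by
    rw [Set.ofPred_forall]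
    refine MeasurableSet.iInter fun i => ?_
    simp only [imp_iff_not_or]
    exact (hR.filt_le n _ (hR.measurableSet_setOf n fun D => i ∉ D)).union
      (𝓜.measurable_X i n (hB i))
  exact (hR.filt_le n _ hE).inter ((𝓜.measurable_noise (n + 1) hC).inter observations)

end Filtration

end Model

/-! ### Change of measure -/

theorem measure_eq_sum_inter_fiber {Ω α : Type*} [MeasurableSpace Ω] [Fintype α] (μ : Measure Ω)
    {r : Ω → α} (hr : ∀ a, MeasurableSet {ω | r ω = a}) (s : Set Ω) :
    μ s = ∑ a, μ ({ω | r ω = a} ∩ s) := by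
  have total := sum_measure_preimage_singleton (μ := μ.restrict s) (f := r) Finset.univ
    fun a _ => hr a
  rw [Finset.coe_univ, Set.preimage_univ, Measure.restrict_apply_univ] at total
  rw [← total]
  exact Finset.sum_congr rfl fun a _ => Measure.restrict_apply (hr a)

namespace Model

section ChangeOfMeasure

variable {M : ℕ} {S Ω : Type*} [MeasurableSpace S] [MeasurableSpace Ω] (𝓜 : Model M S Ω)

/-- The log-likelihood ratio of source `i` at time `n`, oriented in favour of `P A`. -/
noncomputable def slr (A : Finset (Fin M)) (R : ℕ → Ω → Finset (Fin M)) (i : Fin M) : ℕ → Ω → ℝ :=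
  sampledSum R i fun m ω => 𝓜.score A i (𝓜.X i m ω)

/-- The likelihood ratio of `P (symmDiff A U)` against `P A` for the data sampled up to time `n`. -/
noncomputable def lr (A U : Finset (Fin M)) (R : ℕ → Ω → Finset (Fin M)) (n : ℕ) (ω : Ω) : ℝ≥0∞ :=
  ENNReal.ofReal (Real.exp (-∑ i ∈ U, 𝓜.slr A R i n ω))

variable {𝓜} {R : ℕ → Ω → Finset (Fin M)}

theorem slr_eq_ite_llr (A : Finset (Fin M)) (i : Fin M) (n : ℕ) (ω : Ω) :
    𝓜.slr A R i n ω = if i ∈ A then 𝓜.llr R i n ω else -𝓜.llr R i n ω := by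
  by_cases h : i ∈ A
  · simp only [slr, sampledSum, llr, score, h, if_true]
  · simp only [slr, sampledSum, llr, score, h, if_false, ← Finset.sum_neg_distrib]
    refine Finset.sum_congr rfl fun m _ => ?_
    rw [← inv_div, Real.log_inv]
    split_ifs <;> simp

theorem abs_slr (A : Finset (Fin M)) (i : Fin M) (n : ℕ) (ω : Ω) :
    |𝓜.slr A R i n ω| = |𝓜.llr R i n ω| := by
  rw [slr_eq_ite_llr]; split_ifs <;> simp

theorem IsSamplingRule.measurable_slr (hR : 𝓜.IsSamplingRule R) (A : Finset (Fin M)) (i : Fin M)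
    (n : ℕ) : Measurable[𝓜.filt R n] (𝓜.slr A R i n) :=
  measurable_sampledSum fun m hm =>
    (hR.measurable_ite_sampled i m (𝓜.measurable_score A i)).mono (filt_mono 𝓜 R hm) le_rfl

theorem IsSamplingRule.measurable_llr (hR : 𝓜.IsSamplingRule R) (i : Fin M) (n : ℕ) :
    Measurable[𝓜.filt R n] (𝓜.llr R i n) := by
  convert hR.measurable_slr Finset.univ i n using 1
  ext ω
  simp [slr_eq_ite_llr]

theorem IsSamplingRule.measurable_lr (hR : 𝓜.IsSamplingRule R) (A U : Finset (Fin M)) (n : ℕ) :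
    Measurable[𝓜.filt R n] (𝓜.lr A U R n) :=
  (Real.measurable_exp.comp
    (U.measurable_sum fun i _ => hR.measurable_slr A i n).neg).ennreal_ofReal

theorem lr_zero (A U : Finset (Fin M)) (ω : Ω) : 𝓜.lr A U R 0 ω = 1 := by
  simp [lr, slr, sampledSum_zero]

theorem lr_empty (A : Finset (Fin M)) (n : ℕ) (ω : Ω) : 𝓜.lr A ∅ R n ω = 1 := by
  simp [lr]

theorem lr_succ (A U : Finset (Fin M)) (n : ℕ) (ω : Ω) :
    𝓜.lr A U R (n + 1) ω = 𝓜.lr A U R n ω * ∏ i, if i ∈ R (n + 1) ω ∧ i ∈ U then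
      ENNReal.ofReal (Real.exp (-𝓜.score A i (𝓜.X i (n + 1) ω))) else 1 := by
  have increments : ∑ i ∈ U, 𝓜.slr A R i (n + 1) ω = ∑ i ∈ U, 𝓜.slr A R i n ω +
      ∑ i with i ∈ R (n + 1) ω ∧ i ∈ U, 𝓜.score A i (𝓜.X i (n + 1) ω) := by
    have sampledU : ({i | i ∈ R (n + 1) ω ∧ i ∈ U} : Finset (Fin M)) =
        U.filter (· ∈ R (n + 1) ω) := by
      ext i; simp [and_comm]
    rw [sampledU, Finset.sum_filter, ← Finset.sum_add_distrib]
    exact Finset.sum_congr rfl fun i _ => sampledSum_succ n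
  rw [lr, lr, increments, neg_add, Real.exp_add, ENNReal.ofReal_mul (Real.exp_pos _).le,
    ← Finset.prod_filter, ← ENNReal.ofReal_prod_of_nonneg fun i _ => (Real.exp_pos _).le,
    ← Real.exp_sum, Finset.sum_neg_distrib]

theorem setLIntegral_ite_exp_neg_score (A U D : Finset (Fin M)) (i : Fin M) {B : Set S}
    (hB : MeasurableSet B) :
    ∫⁻ x in {x | i ∈ D → x ∈ B}, (if i ∈ D ∧ i ∈ U then
        ENNReal.ofReal (Real.exp (-𝓜.score A i x)) else 1) ∂𝓜.law A i =
      𝓜.law (symmDiff A U) i {x | i ∈ D → x ∈ B} := by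
  by_cases hU : i ∈ U
  · by_cases hD : i ∈ D
    · rw [← 𝓜.law_withDensity_exp_neg_score A i (B := symmDiff A U)
        (by simp [Finset.mem_symmDiff, hU])]
      simp [hU, hD, withDensity_apply _ hB]
    · simp [hD]
  · have hlaw : 𝓜.law (symmDiff A U) i = 𝓜.law A i := by simp [law, Finset.mem_symmDiff, hU]
    simp [hU, hlaw]

theorem IsSamplingRule.setLIntegral_lr_succ (hR : 𝓜.IsSamplingRule R) (A U : Finset (Fin M))
    (n : ℕ) (D : Finset (Fin M)) {E : Set Ω} {C : Set (Fin M → ℝ)} {B : Fin M → Set S}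
    (hE : MeasurableSet[𝓜.filt R n] E) (hC : MeasurableSet C)
    (hB : ∀ i, MeasurableSet (B i)) (hED : ∀ ω ∈ E, R (n + 1) ω = D) :
    ∫⁻ ω in {ω | ω ∈ E ∧ 𝓜.noise (n + 1) ω ∈ C ∧ ∀ i ∈ R (n + 1) ω, 𝓜.X i (n + 1) ω ∈ B i},
        𝓜.lr A U R (n + 1) ω ∂𝓜.P A =
      (∫⁻ ω in E, 𝓜.lr A U R n ω ∂𝓜.P A) *
        (∏ i, 𝓜.law (symmDiff A U) i {x | i ∈ D → x ∈ B i}) *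
          Measure.pi (fun _ => volume.restrict (Set.Ioo (0 : ℝ) 1)) C := by
  have hBD (i : Fin M) : MeasurableSet {x | i ∈ D → x ∈ B i} := by
    by_cases h : i ∈ D <;> simp [h, hB i]
  have hind : Measurable[𝓜.past n] (E.indicator (𝓜.lr A U R n)) :=
    ((hR.measurable_lr A U n).indicator hE).mono (hR.filt_le_past n) le_rfl
  let g (i : Fin M) : S → ℝ≥0∞ := Set.indicator {x | i ∈ D → x ∈ B i} fun x =>
    if i ∈ D ∧ i ∈ U then ENNReal.ofReal (Real.exp (-𝓜.score A i x)) else 1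
  have hg (i : Fin M) : Measurable (g i) := by
    refine Measurable.indicator ?_ (hBD i)
    split_ifs <;> fun_prop
  have factor := 𝓜.lintegral_past_mul_prod_next A n hind hg (measurable_one.indicator hC)
  simp only [g, lintegral_indicator (hR.filt_le n _ hE), lintegral_indicator (hBD _),
    setLIntegral_ite_exp_neg_score A U D _ (hB _), lintegral_indicator_one hC] at factor
  rw [← factor, ← lintegral_indicator
    (hR.measurableSet_of_mem_filtGen n ⟨E, C, B, hE, hC, hB, rfl⟩)]
  refine lintegral_congr fun ω => ?_
  by_cases hω : ω ∈ E
  · classical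
    simp only [Set.indicator_apply, Set.mem_ofPred_eq, hω, if_true, true_and, hED ω hω,
      Finset.prod_ite_zero, lr_succ, Finset.mem_univ, forall_true_left, Pi.one_apply]
    by_cases hZ : 𝓜.noise (n + 1) ω ∈ C <;>
      by_cases hX : ∀ i ∈ D, 𝓜.X i (n + 1) ω ∈ B i <;> simp [hZ, hX]
  · simp [hω]

theorem measure_filt_zero_eq (A B : Finset (Fin M)) {E : Set Ω}
    (hE : MeasurableSet[𝓜.filt R 0] E) : 𝓜.P A E = 𝓜.P B E := by
  rw [show 𝓜.filt R 0 = MeasurableSpace.comap (𝓜.noise 0) inferInstance from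
    𝓜.iSup_comap_Z 0] at hE
  obtain ⟨C, hC, rfl⟩ := hE
  rw [← Measure.map_apply (𝓜.measurable_noise 0) hC,
    ← Measure.map_apply (𝓜.measurable_noise 0) hC, 𝓜.map_noise, 𝓜.map_noise]

theorem IsSamplingRule.setLIntegral_lr_succ_of_mem_filtGen (hR : 𝓜.IsSamplingRule R)
    (A U : Finset (Fin M)) (n : ℕ)
    (ih : ∀ E, MeasurableSet[𝓜.filt R n] E →
      ∫⁻ ω in E, 𝓜.lr A U R n ω ∂𝓜.P A = 𝓜.P (symmDiff A U) E)
    {s : Set Ω} (hs : s ∈ 𝓜.filtGen R n) :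
    ∫⁻ ω in s, 𝓜.lr A U R (n + 1) ω ∂𝓜.P A = 𝓜.P (symmDiff A U) s := by
  have hsm := hR.measurableSet_of_mem_filtGen n hs
  have hfiber (D : Finset (Fin M)) : MeasurableSet {ω | R (n + 1) ω = D} :=
    hR.filt_le n _ (hR n D)
  rw [← withDensity_apply _ hsm, measure_eq_sum_inter_fiber _ hfiber s,
    measure_eq_sum_inter_fiber _ hfiber s]
  refine Finset.sum_congr rfl fun D _ => ?_
  rw [withDensity_apply _ ((hfiber D).inter hsm)]
  obtain ⟨E, C, B, hE, hC, hB, rfl⟩ := hs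
  have hED : MeasurableSet[𝓜.filt R n] (E ∩ {ω | R (n + 1) ω = D}) := hE.inter (hR n D)
  have onFiber : {ω | R (n + 1) ω = D} ∩
      {ω | ω ∈ E ∧ 𝓜.noise (n + 1) ω ∈ C ∧ ∀ i ∈ R (n + 1) ω, 𝓜.X i (n + 1) ω ∈ B i} =
      {ω | ω ∈ E ∩ {ω | R (n + 1) ω = D} ∧ 𝓜.noise (n + 1) ω ∈ C ∧
        ∀ i ∈ R (n + 1) ω, 𝓜.X i (n + 1) ω ∈ B i} := by
    ext ω
    simp only [Set.mem_inter_iff, Set.mem_ofPred_eq]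
    tauto
  have changed := hR.setLIntegral_lr_succ A U n D hED hC hB fun ω h => h.2
  -- With no source changed the likelihood ratio is `1`, so this computes a probability.
  have unchanged := hR.setLIntegral_lr_succ (symmDiff A U) ∅ n D hED hC hB fun ω h => h.2
  simp only [lr_empty, setLIntegral_one, show symmDiff (symmDiff A U) ∅ = symmDiff A U from
    symmDiff_bot _] at unchanged
  rw [onFiber, changed, unchanged, ih _ hED]

theorem IsSamplingRule.setLIntegral_lr (hR : 𝓜.IsSamplingRule R) (A U : Finset (Fin M)) (n : ℕ)
    {E : Set Ω} (hE : MeasurableSet[𝓜.filt R n] E) :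
    ∫⁻ ω in E, 𝓜.lr A U R n ω ∂𝓜.P A = 𝓜.P (symmDiff A U) E := by
  induction n generalizing E with
  | zero =>
    simp only [lr_zero, setLIntegral_one]
    exact measure_filt_zero_eq _ _ hE
  | succ n ih =>
    have generators (s : Set Ω) (hs : s ∈ 𝓜.filtGen R n) :
        (𝓜.P A).withDensity (𝓜.lr A U R (n + 1)) s = 𝓜.P (symmDiff A U) s := by
      rw [withDensity_apply _ (hR.measurableSet_of_mem_filtGen n hs),
        hR.setLIntegral_lr_succ_of_mem_filtGen A U n (fun E => ih) hs]
    have total := generators _ (univ_mem_filtGen n)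
    have hfin : IsFiniteMeasure ((𝓜.P A).withDensity (𝓜.lr A U R (n + 1))) :=
      ⟨by rw [total]; exact measure_lt_top _ _⟩
    rw [← withDensity_apply _ (hR.filt_le (n + 1) _ hE)]
    exact ext_on_measurableSpace_of_generate_finite _ (𝓜.filtGen R n) generators
      (MeasurableSpace.generateFrom_le fun s => hR.measurableSet_of_mem_filtGen n) rfl
      (isPiSystem_filtGen n) total (hR.filt_succ_le_generateFrom_filtGen n _ hE)

end ChangeOfMeasure

end Model

namespace Model

/-! ### Predictable sampling -/

section Predictable

variable {M : ℕ} {S Ω : Type*} [MeasurableSpace S] [MeasurableSpace Ω] {𝓜 : Model M S Ω}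
  {R : ℕ → Ω → Finset (Fin M)} {i : Fin M}

/-- Whether source `i` is sampled at time `n + 1` depends only on the variables up to time `n`,
observed or not. -/
def SamplesPredictably (𝓜 : Model M S Ω) (R : ℕ → Ω → Finset (Fin M)) (i : Fin M) : Prop :=
  ∀ n, MeasurableSet[𝓜.past n] {ω | i ∈ R (n + 1) ω}

theorem IsSamplingRule.samplesPredictably (hR : 𝓜.IsSamplingRule R) (i : Fin M) :
    𝓜.SamplesPredictably R i :=
  fun n => hR.filt_le_past n _ (hR.measurableSet_setOf n fun D => i ∈ D)

theorem SamplesPredictably.measurable_sampledSum_past (hR : 𝓜.SamplesPredictably R i) {g : S → ℝ}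
    (hg : Measurable g) (n : ℕ) :
    Measurable[𝓜.past n] (sampledSum R i (fun m ω => g (𝓜.X i m ω)) n) :=
  measurable_sampledSum fun m hm => Measurable.ite (𝓜.past_mono hm.le _ (hR m))
    (hg.comp (measurable_sigmaOf_X hm)) measurable_const

theorem SamplesPredictably.lintegral_exp_sampledSum_le_one (hR : 𝓜.SamplesPredictably R i)
    (A : Finset (Fin M)) {g : S → ℝ} (hg : Measurable g)
    (hg1 : ∫⁻ x, ENNReal.ofReal (Real.exp (g x)) ∂𝓜.law A i ≤ 1) (n : ℕ) :
    ∫⁻ ω, ENNReal.ofReal (Real.exp (sampledSum R i (fun m ω => g (𝓜.X i m ω)) n ω)) ∂𝓜.P A ≤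
      1 := by
  induction n with
  | zero => simp [sampledSum_zero]
  | succ n ih =>
    let h (ω : Ω) : ℝ≥0∞ :=
      ENNReal.ofReal (Real.exp (sampledSum R i (fun m ω => g (𝓜.X i m ω)) n ω))
    let E : Set Ω := {ω | i ∈ R (n + 1) ω}
    have hh : Measurable[𝓜.past n] h :=
      (Real.measurable_exp.comp (hR.measurable_sampledSum_past hg n)).ennreal_ofReal
    have hpast : MeasurableSet[𝓜.past n] E := hR n
    have hE : MeasurableSet E := 𝓜.past_le n _ hpast
    have split (ω : Ω) :
        ENNReal.ofReal (Real.exp (sampledSum R i (fun m ω => g (𝓜.X i m ω)) (n + 1) ω)) =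
          E.indicator h ω * ENNReal.ofReal (Real.exp (g (𝓜.X i (n + 1) ω))) +
            Eᶜ.indicator h ω := by
      rw [sampledSum_succ, Real.exp_add, ENNReal.ofReal_mul (Real.exp_pos _).le]
      by_cases hω : i ∈ R (n + 1) ω <;> simp [E, h, hω]
    calc _ = (∫⁻ ω, E.indicator h ω ∂𝓜.P A) *
          (∫⁻ x, ENNReal.ofReal (Real.exp (g x)) ∂𝓜.law A i) + ∫⁻ ω, Eᶜ.indicator h ω ∂𝓜.P A := by
          simp only [split]
          rw [lintegral_add_right _ ((hh.indicator hpast.compl).mono (𝓜.past_le n) le_rfl),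
            𝓜.lintegral_past_mul_next A i n (hh.indicator hpast)
              (g := fun x => ENNReal.ofReal (Real.exp (g x))) (by fun_prop)]
      _ ≤ ∫⁻ ω, E.indicator h ω ∂𝓜.P A + ∫⁻ ω, Eᶜ.indicator h ω ∂𝓜.P A := by
          gcongr; exact mul_le_of_le_one_right' hg1
      _ = ∫⁻ ω, h ω ∂𝓜.P A := by
          rw [lintegral_indicator hE, lintegral_indicator hE.compl, lintegral_add_compl _ hE]
      _ ≤ 1 := ih

theorem integrable_comp_X (A : Finset (Fin M)) (n : ℕ) {g : S → ℝ}
    (hg : Integrable g (𝓜.law A i)) :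
    Integrable (fun ω => g (𝓜.X i (n + 1) ω)) (𝓜.P A) :=
  Integrable.comp_measurable (by rwa [𝓜.map_X]) (𝓜.measurable_X i n)

theorem setIntegral_past_comp_X (A : Finset (Fin M)) (n : ℕ) {E : Set Ω}
    (hE : MeasurableSet[𝓜.past n] E) {g : S → ℝ} (hgm : Measurable g)
    (hg : Integrable g (𝓜.law A i)) :
    ∫ ω in E, g (𝓜.X i (n + 1) ω) ∂𝓜.P A = (𝓜.P A).real E * ∫ x, g x ∂𝓜.law A i := by
  have hind : Indep (𝓜.sigmaOf {Sum.inl (i, n)}) (𝓜.past n) (𝓜.P A) :=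
    indep_iSup_of_disjoint 𝓜.varSigma_le (𝓜.indep A)
      (Set.disjoint_singleton_left.2 (by simp [pastIdx]))
  have hmeas : Measurable[𝓜.sigmaOf {Sum.inl (i, n)}] fun ω => g (𝓜.X i (n + 1) ω) :=
    hgm.comp (measurable_sigmaOf_X rfl)
  rw [← setIntegral_condExp (𝓜.past_le n) (integrable_comp_X A n hg) hE,
    setIntegral_congr_ae (g := fun _ => ∫ ω, g (𝓜.X i (n + 1) ω) ∂𝓜.P A) (𝓜.past_le n _ hE)
      ((condExp_indep_eq (𝓜.sigmaOf_le _) (𝓜.past_le n) hmeas.stronglyMeasurable hind).mono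
        fun _ h _ => h),
    setIntegral_const, smul_eq_mul, ← 𝓜.map_X A i n,
    integral_map (𝓜.measurable_X i n).aemeasurable hgm.aestronglyMeasurable]

theorem SamplesPredictably.integrable_ite_sampled (hR : 𝓜.SamplesPredictably R i)
    (A : Finset (Fin M)) (n : ℕ) {g : S → ℝ} (hg : Integrable g (𝓜.law A i)) :
    Integrable (fun ω => if i ∈ R (n + 1) ω then g (𝓜.X i (n + 1) ω) else 0) (𝓜.P A) := by
  refine ((integrable_comp_X A n hg).indicator (𝓜.past_le n _ (hR n))).congr
    (Eventually.of_forall fun ω => ?_)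
  simp [Set.indicator_apply]

theorem SamplesPredictably.integrable_sampledSum (hR : 𝓜.SamplesPredictably R i)
    (A : Finset (Fin M)) {g : S → ℝ} (hg : Integrable g (𝓜.law A i)) (n : ℕ) :
    Integrable (sampledSum R i (fun m ω => g (𝓜.X i m ω)) n) (𝓜.P A) := by
  refine integrable_finsetSum _ fun m hm => ?_
  obtain ⟨j, rfl⟩ := Nat.exists_eq_add_of_le' (Finset.mem_Icc.1 hm).1
  exact hR.integrable_ite_sampled A j hg

theorem SamplesPredictably.integral_sampledSum_succ (hR : 𝓜.SamplesPredictably R i)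
    (A : Finset (Fin M)) {g : S → ℝ} (hgm : Measurable g) (hg : Integrable g (𝓜.law A i)) (n : ℕ) :
    ∫ ω, sampledSum R i (fun m ω => g (𝓜.X i m ω)) (n + 1) ω ∂𝓜.P A =
      ∫ ω, sampledSum R i (fun m ω => g (𝓜.X i m ω)) n ω ∂𝓜.P A +
        (𝓜.P A).real {ω | i ∈ R (n + 1) ω} * ∫ x, g x ∂𝓜.law A i := by
  simp only [sampledSum_succ]
  rw [integral_add (hR.integrable_sampledSum A hg n) (hR.integrable_ite_sampled A n hg),
    ← setIntegral_past_comp_X A n (hR n) hgm hg, ← integral_indicator (𝓜.past_le n _ (hR n))]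
  simp [Set.indicator_apply]

theorem SamplesPredictably.integrable_count (hR : 𝓜.SamplesPredictably R i) (A : Finset (Fin M))
    (n : ℕ) : Integrable (count R i n) (𝓜.P A) :=
  hR.integrable_sampledSum A (integrable_const 1) n

theorem SamplesPredictably.integral_sampledSum (hR : 𝓜.SamplesPredictably R i)
    (A : Finset (Fin M)) {g : S → ℝ} (hgm : Measurable g) (hg : Integrable g (𝓜.law A i)) (n : ℕ) :
    ∫ ω, sampledSum R i (fun m ω => g (𝓜.X i m ω)) n ω ∂𝓜.P A =
      (∫ ω, count R i n ω ∂𝓜.P A) * ∫ x, g x ∂𝓜.law A i := by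
  induction n with
  | zero => simp [sampledSum_zero, count]
  | succ n ih =>
    have step : ∫ ω, count R i (n + 1) ω ∂𝓜.P A =
        ∫ ω, count R i n ω ∂𝓜.P A + (𝓜.P A).real {ω | i ∈ R (n + 1) ω} := by
      simpa only [count, integral_const, probReal_univ, smul_eq_mul, mul_one] using
        hR.integral_sampledSum_succ A measurable_const (integrable_const (1 : ℝ)) n
    rw [hR.integral_sampledSum_succ A hgm hg, ih, step, add_mul]

theorem SamplesPredictably.integrable_slr (hR : 𝓜.SamplesPredictably R i) (A : Finset (Fin M))
    (n : ℕ) : Integrable (𝓜.slr A R i n) (𝓜.P A) :=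
  hR.integrable_sampledSum A (𝓜.integrable_score A i) n

theorem SamplesPredictably.integral_slr (hR : 𝓜.SamplesPredictably R i) (A : Finset (Fin M))
    (n : ℕ) : ∫ ω, 𝓜.slr A R i n ω ∂𝓜.P A = (∫ ω, count R i n ω ∂𝓜.P A) * 𝓜.info A i := by
  rw [← 𝓜.integral_score A i]
  exact hR.integral_sampledSum A (𝓜.measurable_score A i) (𝓜.integrable_score A i) n

theorem SamplesPredictably.lintegral_exp_neg_slr_le_one (hR : 𝓜.SamplesPredictably R i)
    (A : Finset (Fin M)) (n : ℕ) :
    ∫⁻ ω, ENNReal.ofReal (Real.exp (-𝓜.slr A R i n ω)) ∂𝓜.P A ≤ 1 := by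
  have neg (ω : Ω) : -𝓜.slr A R i n ω =
      sampledSum R i (fun m ω => -𝓜.score A i (𝓜.X i m ω)) n ω := by
    simp only [slr, sampledSum, ← Finset.sum_neg_distrib]
    exact Finset.sum_congr rfl fun m _ => by split_ifs <;> simp
  simp only [neg]
  exact hR.lintegral_exp_sampledSum_le_one A (𝓜.measurable_score A i).neg
    (𝓜.lintegral_exp_neg_score A i).le n

theorem SamplesPredictably.exists_measure_slr_le_exp (hR : 𝓜.SamplesPredictably R i)
    (A : Finset (Fin M)) {ρ a : ℝ} (hρ : 0 < ρ) (ha : a < 𝓜.info A i) :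
    ∃ b > 0, ∀ n : ℕ,
      𝓜.P A {ω | ρ * n ≤ count R i n ω ∧ 𝓜.slr A R i n ω ≤ a * count R i n ω} ≤
        ENNReal.ofReal (Real.exp (-(b * n))) := by
  obtain ⟨a', haa', ha'⟩ := exists_between ha
  obtain ⟨θ, hθ, hmgf⟩ := 𝓜.exists_lintegral_exp_mul_sub_score_le_one A i ha'
  have gap : 0 < θ * (a' - a) := mul_pos hθ (sub_pos.2 haa')
  refine ⟨θ * (a' - a) * ρ, mul_pos gap hρ, fun n => ?_⟩
  let tilt (x : S) : ℝ := θ * (a' - 𝓜.score A i x)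
  have htilt : Measurable tilt := by fun_prop
  have tilted (ω : Ω) : sampledSum R i (fun m ω => tilt (𝓜.X i m ω)) n ω =
      θ * (a' * count R i n ω - 𝓜.slr A R i n ω) := by
    simp only [sampledSum, slr, count, Finset.mul_sum, ← Finset.sum_sub_distrib, tilt]
    exact Finset.sum_congr rfl fun m _ => by split_ifs <;> ring
  have hmeas : Measurable fun ω =>
      ENNReal.ofReal (Real.exp (sampledSum R i (fun m ω => tilt (𝓜.X i m ω)) n ω)) :=
    (Real.measurable_exp.comp
      ((hR.measurable_sampledSum_past htilt n).mono (𝓜.past_le n) le_rfl)).ennreal_ofReal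
  calc 𝓜.P A {ω | ρ * n ≤ count R i n ω ∧ 𝓜.slr A R i n ω ≤ a * count R i n ω}
      ≤ 𝓜.P A {ω | ENNReal.ofReal (Real.exp (θ * (a' - a) * ρ * n)) ≤
          ENNReal.ofReal (Real.exp (sampledSum R i (fun m ω => tilt (𝓜.X i m ω)) n ω))} := by
        refine measure_mono fun ω hω => ENNReal.ofReal_le_ofReal (Real.exp_le_exp.2 ?_)
        calc θ * (a' - a) * ρ * n = θ * (a' - a) * (ρ * n) := by ring
          _ ≤ θ * (a' - a) * count R i n ω := by gcongr; exact hω.1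
          _ = θ * (a' * count R i n ω - a * count R i n ω) := by ring
          _ ≤ θ * (a' * count R i n ω - 𝓜.slr A R i n ω) := by gcongr; exact hω.2
          _ = _ := (tilted ω).symm
    _ ≤ 1 / ENNReal.ofReal (Real.exp (θ * (a' - a) * ρ * n)) :=
        (meas_ge_le_lintegral_div hmeas.aemeasurable (by simp [Real.exp_pos])
          ENNReal.ofReal_ne_top).trans
            (ENNReal.div_le_div_right (hR.lintegral_exp_sampledSum_le_one A htilt hmgf n) _)
    _ = ENNReal.ofReal (Real.exp (-(θ * (a' - a) * ρ * n))) := by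
        rw [one_div, ← ENNReal.ofReal_inv_of_pos (Real.exp_pos _), Real.exp_neg]

end Predictable

end Model

/-! ### Stopped policies -/

theorem setOf_le_natCast_and_eq_biUnion {Ω : Type*} (T : Ω → ℕ∞) (q : Ω → Prop) (N : ℕ) :
    {ω | T ω ≤ N ∧ q ω} = ⋃ n ∈ Finset.range (N + 1), {ω | T ω = n ∧ q ω} := by
  ext ω
  simp only [Set.mem_ofPred_eq, Set.mem_iUnion, Finset.mem_range, exists_prop]
  refine ⟨fun ⟨hT, hq⟩ => ?_, fun ⟨n, hn, hT, hq⟩ => ⟨?_, hq⟩⟩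
  · obtain ⟨n, hn⟩ := ENat.ne_top_iff_exists.1 (ne_top_of_le_ne_top (ENat.natCast_ne_top N) hT)
    rw [← hn, Nat.cast_le] at hT
    exact ⟨n, Nat.lt_succ_of_le hT, hn.symm, hq⟩
  · rw [hT, Nat.cast_le]
    exact Nat.le_of_lt_succ hn

theorem tendsto_measure_le_natCast_and {Ω : Type*} [MeasurableSpace Ω] (μ : Measure Ω)
    (T : Ω → ℕ∞) (q : Ω → Prop) :
    Tendsto (fun N : ℕ => μ {ω | T ω ≤ N ∧ q ω}) atTop (𝓝 (μ {ω | T ω ≠ ⊤ ∧ q ω})) := by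
  have union : {ω | T ω ≠ ⊤ ∧ q ω} = ⋃ N : ℕ, {ω | T ω ≤ N ∧ q ω} := by
    ext ω
    simp only [Set.mem_ofPred_eq, Set.mem_iUnion, exists_and_right, ENat.ne_top_iff_exists]
    refine and_congr_left fun _ => ⟨fun ⟨n, hn⟩ => ⟨n, hn.ge⟩, fun ⟨n, hn⟩ => ?_⟩
    exact ENat.ne_top_iff_exists.1 (ne_top_of_le_ne_top (ENat.natCast_ne_top n) hn)
  rw [union]
  exact tendsto_measure_iUnion_atTop fun m n hmn ω hω =>
    ⟨hω.1.trans (Nat.cast_le.2 hmn), hω.2⟩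

namespace Model

section Stopped

variable {M : ℕ} {S Ω : Type*} [MeasurableSpace S] [MeasurableSpace Ω] {𝓜 : Model M S Ω}
  {p : Triplet M Ω}

theorem IsPolicy.measurableSet_filt_T_eq_and (hp : 𝓜.IsPolicy p) (n : ℕ)
    (q : Finset (Fin M) → Prop) :
    MeasurableSet[𝓜.filt p.R n] {ω | p.T ω = n ∧ q (p.Δ ω)} := by
  rcases n.eq_zero_or_pos with rfl | hn
  · have empty : {ω | p.T ω = (0 : ℕ) ∧ q (p.Δ ω)} = ∅ :=
      Set.eq_empty_of_forall_notMem fun ω hω => by simpa [hω.1] using hp.2.1 ω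
    rw [empty]
    exact @MeasurableSet.empty _ (𝓜.filt p.R 0)
  · have union : {ω | p.T ω = n ∧ q (p.Δ ω)} =
        ⋃ D ∈ {D | q D}, {ω | p.T ω = n ∧ p.Δ ω = D} := by
      ext ω
      simp only [Set.mem_ofPred_eq, Set.mem_iUnion, exists_prop]
      exact ⟨fun h => ⟨_, h.2, h.1, rfl⟩, fun ⟨_, hD, h, hΔ⟩ => ⟨h, hΔ ▸ hD⟩⟩
    rw [union]
    exact MeasurableSet.biUnion (Set.to_countable _) fun D _ => hp.2.2.2 n hn D

theorem IsPolicy.measurable_T (hp : 𝓜.IsPolicy p) : Measurable p.T := by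
  have hT (n : ℕ) : MeasurableSet {ω | p.T ω = n} := by
    simpa using hp.1.filt_le n _ (hp.measurableSet_filt_T_eq_and n fun _ => True)
  refine measurable_to_countable' fun x => ?_
  induction x using ENat.recTopCoe with
  | top =>
    have infinite : p.T ⁻¹' {⊤} = (⋃ n : ℕ, {ω | p.T ω = n})ᶜ := by
      ext ω
      rw [Set.mem_preimage, Set.mem_singleton_iff, ← not_ne_iff, ENat.ne_top_iff_exists]
      simp [eq_comm]
    rw [infinite]
    exact (MeasurableSet.iUnion hT).compl
  | coe n => exact hT n

theorem IsPolicy.samplesPredictably_stopped (hp : 𝓜.IsPolicy p) (i : Fin M) :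
    𝓜.SamplesPredictably (stopped p.R p.T) i := by
  intro n
  have running : {ω | i ∈ stopped p.R p.T (n + 1) ω} =
      (⋃ m ∈ Finset.range (n + 1), {ω | p.T ω = m})ᶜ ∩ {ω | i ∈ p.R (n + 1) ω} := by
    ext ω
    have lt_iff : ((n + 1 : ℕ) : ℕ∞) ≤ p.T ω ↔ ∀ m ≤ n, p.T ω ≠ m := by
      induction p.T ω using ENat.recTopCoe with
      | top => simp
      | coe t =>
        simp only [Nat.cast_le, ne_eq, Nat.cast_inj]
        exact ⟨fun h m hm => by lia, fun h => not_le.1 fun ht => h t ht rfl⟩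
    by_cases h : ((n + 1 : ℕ) : ℕ∞) ≤ p.T ω
    · simpa [stopped, -Nat.cast_add, h] using fun _ => lt_iff.1 h
    · simpa [stopped, -Nat.cast_add, h] using fun h' => absurd (lt_iff.2 h') h
  rw [running]
  refine hp.1.filt_le_past n _ (MeasurableSet.inter (MeasurableSet.compl ?_)
    (hp.1.measurableSet_setOf n fun D => i ∈ D))
  refine Finset.measurableSet_biUnion _ fun m hm => ?_
  exact filt_mono 𝓜 p.R (Nat.lt_succ_iff.1 (Finset.mem_range.1 hm)) _
    (by simpa using hp.measurableSet_filt_T_eq_and m fun _ => True)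

theorem slr_stopped (A : Finset (Fin M)) {i : Fin M} {n N : ℕ} {ω : Ω} (hT : p.T ω = n)
    (hn : n ≤ N) : 𝓜.slr A (stopped p.R p.T) i N ω = 𝓜.slr A p.R i n ω := by
  rw [slr, sampledSum_stopped hT, min_eq_right hn, slr]

theorem IsPolicy.measurableSet_T_le_and (hp : 𝓜.IsPolicy p) (N : ℕ)
    (q : Finset (Fin M) → Prop) : MeasurableSet {ω | p.T ω ≤ N ∧ q (p.Δ ω)} := by
  rw [setOf_le_natCast_and_eq_biUnion]
  exact Finset.measurableSet_biUnion _ fun n _ =>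
    hp.1.filt_le n _ (hp.measurableSet_filt_T_eq_and n q)

theorem IsPolicy.measurable_lr_stopped (hp : 𝓜.IsPolicy p) (A U : Finset (Fin M)) (N : ℕ) :
    Measurable (𝓜.lr A U (stopped p.R p.T) N) :=
  (Real.measurable_exp.comp (U.measurable_sum fun i _ =>
    ((hp.samplesPredictably_stopped i).measurable_sampledSum_past
      (𝓜.measurable_score A i) N).mono (𝓜.past_le N) le_rfl).neg).ennreal_ofReal

theorem IsPolicy.setLIntegral_lr_stopped (hp : 𝓜.IsPolicy p) (A U : Finset (Fin M)) (N : ℕ)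
    (q : Finset (Fin M) → Prop) :
    ∫⁻ ω in {ω | p.T ω ≤ N ∧ q (p.Δ ω)}, 𝓜.lr A U (stopped p.R p.T) N ω ∂𝓜.P A =
      𝓜.P (symmDiff A U) {ω | p.T ω ≤ N ∧ q (p.Δ ω)} := by
  have hE (n : ℕ) := hp.measurableSet_filt_T_eq_and n q
  have disjoint : Set.PairwiseDisjoint (Finset.range (N + 1) : Set ℕ)
      fun n => {ω | p.T ω = n ∧ q (p.Δ ω)} := fun m _ n _ hmn =>
    Set.disjoint_left.2 fun ω hm hn => hmn (Nat.cast_injective (hm.1.symm.trans hn.1))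
  rw [setOf_le_natCast_and_eq_biUnion,
    lintegral_biUnion_finset disjoint fun n _ => hp.1.filt_le n _ (hE n),
    measure_biUnion_finset disjoint fun n _ => hp.1.filt_le n _ (hE n)]
  refine Finset.sum_congr rfl fun n hn => ?_
  rw [← hp.1.setLIntegral_lr A U n (hE n)]
  refine setLIntegral_congr_fun (hp.1.filt_le n _ (hE n)) fun ω hω => ?_
  simp only [lr, slr_stopped A hω.1 (Nat.le_of_lt_succ (Finset.mem_range.1 hn))]

end Stopped

end Model

/-! ### The lower bound -/

theorem neg_log_le_add_exp_neg_div {α : ℝ} (hα : 0 < α) (x : ℝ) :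
    -Real.log α ≤ x + Real.exp (-x) / α := by
  have h := Real.log_le_sub_one_of_pos (show 0 < Real.exp (-x) / α by positivity)
  rw [Real.log_div (Real.exp_pos _).ne' hα.ne', Real.log_exp] at h
  linarith

theorem sum_le_sum_add_exp_neg {ι : Type*} {V U : Finset ι} (h : V ⊆ U) (x : ι → ℝ) :
    ∑ i ∈ V, x i ≤ ∑ i ∈ U, (x i + Real.exp (-x i)) :=
  (Finset.sum_le_sum fun i _ => le_add_of_nonneg_right (Real.exp_pos (-x i)).le).trans
    (Finset.sum_le_sum_of_subset_of_nonneg h fun i _ _ => by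
      linarith [Real.add_one_le_exp (-x i)])

namespace Model

section LowerBound

variable {M : ℕ} {S Ω : Type*} [MeasurableSpace S] [MeasurableSpace Ω] {𝓜 : Model M S Ω}
  {R : ℕ → Ω → Finset (Fin M)} {p : Triplet M Ω} {i : Fin M}

theorem SamplesPredictably.integrable_exp_neg_slr (hR : 𝓜.SamplesPredictably R i)
    (A : Finset (Fin M)) (n : ℕ) :
    Integrable (fun ω => Real.exp (-𝓜.slr A R i n ω)) (𝓜.P A) := by
  have hmeas := Real.measurable_exp.comp
    ((hR.measurable_sampledSum_past (𝓜.measurable_score A i) n).mono (𝓜.past_le n) le_rfl).neg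
  exact (lintegral_ofReal_ne_top_iff_integrable hmeas.aestronglyMeasurable
    (Eventually.of_forall fun ω => (Real.exp_pos _).le)).1
      (ne_top_of_le_ne_top ENNReal.one_ne_top (hR.lintegral_exp_neg_slr_le_one A n))

theorem SamplesPredictably.integral_slr_add_exp_neg_le (hR : 𝓜.SamplesPredictably R i)
    (A : Finset (Fin M)) (n : ℕ) :
    ∫ ω, (𝓜.slr A R i n ω + Real.exp (-𝓜.slr A R i n ω)) ∂𝓜.P A ≤
      (∫ ω, count R i n ω ∂𝓜.P A) * 𝓜.info A i + 1 := by
  rw [integral_add (hR.integrable_slr A n) (hR.integrable_exp_neg_slr A n), hR.integral_slr,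
    integral_eq_lintegral_of_nonneg_ae (Eventually.of_forall fun ω => (Real.exp_pos _).le)
      (hR.integrable_exp_neg_slr A n).aestronglyMeasurable]
  gcongr
  exact ENNReal.toReal_le_of_le_ofReal zero_le_one
    (by simpa using hR.lintegral_exp_neg_slr_le_one A n)

/-- The event that `p` stops by time `N` and that the sources of `U` that it identifies
correctly under `P A` are those of `V`. -/
def correctOn (A : Finset (Fin M)) (p : Triplet M Ω) (N : ℕ) (U V : Finset (Fin M)) : Set Ω :=
  {ω | p.T ω ≤ N ∧ U \ symmDiff A (p.Δ ω) = V}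

theorem measure_correctOn_le {α : ℝ} {k : ℕ} (herr : 𝓜.ErrorConstraint α k p)
    (A : Finset (Fin M)) {U : Finset (Fin M)} (hU : U.card = k) (N : ℕ) (V : Finset (Fin M)) :
    𝓜.P (symmDiff A V) (correctOn A p N U V) ≤ ENNReal.ofReal α := by
  refine (measure_mono ?_).trans (herr (symmDiff A V))
  rintro ω ⟨hT, rfl⟩
  refine ⟨ne_top_of_le_ne_top (ENat.natCast_ne_top N) hT, ?_⟩
  -- Changing the status of the correctly identified sources of `U` makes all of `U` erroneous.
  rw [← hU]
  refine Finset.card_le_card fun i hi => ?_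
  simp only [Finset.mem_symmDiff, Finset.mem_sdiff, hi, true_and]
  tauto

theorem IsPolicy.integrable_indicator_lr (hp : 𝓜.IsPolicy p) (A U V : Finset (Fin M)) (N : ℕ) :
    Integrable ((correctOn A p N U V).indicator
      fun ω => (𝓜.lr A V (stopped p.R p.T) N ω).toReal) (𝓜.P A) := by
  have hG : MeasurableSet (correctOn A p N U V) :=
    hp.measurableSet_T_le_and N fun D => U \ symmDiff A D = V
  refine IntegrableOn.integrable_indicator (integrable_toReal_of_lintegral_ne_top
    (hp.measurable_lr_stopped A V N).aemeasurable ?_) hG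
  exact ne_of_eq_of_ne (hp.setLIntegral_lr_stopped A V N fun D => U \ symmDiff A D = V)
    (measure_ne_top _ _)

theorem IsPolicy.integral_indicator_lr (hp : 𝓜.IsPolicy p) (A U V : Finset (Fin M)) (N : ℕ) :
    ∫ ω, (correctOn A p N U V).indicator
      (fun ω => (𝓜.lr A V (stopped p.R p.T) N ω).toReal) ω ∂𝓜.P A =
      (𝓜.P (symmDiff A V)).real (correctOn A p N U V) := by
  have hG : MeasurableSet (correctOn A p N U V) :=
    hp.measurableSet_T_le_and N fun D => U \ symmDiff A D = V
  rw [integral_indicator hG, integral_toReal (hp.measurable_lr_stopped A V N).aemeasurable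
    (Eventually.of_forall fun ω => ENNReal.ofReal_lt_top)]
  exact congrArg ENNReal.toReal
    (hp.setLIntegral_lr_stopped A V N fun D => U \ symmDiff A D = V)

theorem neg_log_indicator_le {α : ℝ} (hα : 0 < α) (A U : Finset (Fin M)) (N : ℕ) (ω : Ω) :
    {ω | p.T ω ≤ N}.indicator (fun _ => -Real.log α) ω ≤
      ∑ i ∈ U, (𝓜.slr A (stopped p.R p.T) i N ω +
        Real.exp (-𝓜.slr A (stopped p.R p.T) i N ω)) +
      (∑ V ∈ U.powerset, (correctOn A p N U V).indicator
        (fun ω => (𝓜.lr A V (stopped p.R p.T) N ω).toReal) ω) / α := by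
  let x (i : Fin M) : ℝ := 𝓜.slr A (stopped p.R p.T) i N ω
  have nonneg (V : Finset (Fin M)) : 0 ≤ (correctOn A p N U V).indicator
      (fun ω => (𝓜.lr A V (stopped p.R p.T) N ω).toReal) ω :=
    Set.indicator_nonneg (fun _ _ => ENNReal.toReal_nonneg) ω
  by_cases hT : p.T ω ≤ N
  · let V := U \ symmDiff A (p.Δ ω)
    have hV : V ⊆ U := Finset.sdiff_subset
    have term : Real.exp (-∑ i ∈ V, x i) ≤ ∑ V ∈ U.powerset, (correctOn A p N U V).indicator
        (fun ω => (𝓜.lr A V (stopped p.R p.T) N ω).toReal) ω := by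
      refine le_of_eq_of_le ?_ (Finset.single_le_sum (fun V _ => nonneg V)
        (Finset.mem_powerset.2 hV))
      rw [Set.indicator_of_mem (show ω ∈ correctOn A p N U V from ⟨hT, rfl⟩), lr,
        ENNReal.toReal_ofReal (Real.exp_pos _).le]
    rw [Set.indicator_of_mem (by exact hT)]
    calc -Real.log α ≤ ∑ i ∈ V, x i + Real.exp (-∑ i ∈ V, x i) / α :=
          neg_log_le_add_exp_neg_div hα _
      _ ≤ _ := add_le_add (sum_le_sum_add_exp_neg hV x) (by gcongr)
  · rw [Set.indicator_of_notMem (by exact hT)]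
    exact add_nonneg (sum_le_sum_add_exp_neg (Finset.empty_subset U) x)
      (div_nonneg (Finset.sum_nonneg fun V _ => nonneg V) hα.le)

theorem IsPolicy.neg_log_mul_measure_le (hp : 𝓜.IsPolicy p) {α : ℝ} (hα : 0 < α) {k : ℕ}
    (herr : 𝓜.ErrorConstraint α k p) (A : Finset (Fin M)) {U : Finset (Fin M)}
    (hU : U.card = k) (N : ℕ) :
    -Real.log α * (𝓜.P A).real {ω | p.T ω ≤ N} ≤
      ∑ i ∈ U, (∫ ω, count (stopped p.R p.T) i N ω ∂𝓜.P A) * 𝓜.info A i + (k + 2 ^ k) := by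
  have hpred := hp.samplesPredictably_stopped
  have hT : MeasurableSet {ω | p.T ω ≤ N} := by
    simpa using hp.measurableSet_T_le_and N fun _ => True
  have integrable_slr := fun (i : Fin M) (_ : i ∈ U) =>
    ((hpred i).integrable_slr A N).add ((hpred i).integrable_exp_neg_slr A N)
  have integrable_lr := fun (V : Finset (Fin M)) (_ : V ∈ U.powerset) =>
    hp.integrable_indicator_lr A U V N
  have changed : ∑ V ∈ U.powerset, (𝓜.P (symmDiff A V)).real (correctOn A p N U V) ≤
      2 ^ k * α := by
    refine (Finset.sum_le_card_nsmul _ _ α fun V _ =>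
      ENNReal.toReal_le_of_le_ofReal hα.le (measure_correctOn_le herr A hU N V)).trans_eq ?_
    rw [Finset.card_powerset, hU, nsmul_eq_mul, Nat.cast_pow, Nat.cast_ofNat]
  have mono := integral_mono ((integrable_const (-Real.log α)).indicator hT)
    ((integrable_finsetSum _ integrable_slr).add
      ((integrable_finsetSum _ integrable_lr).div_const α))
    fun ω => neg_log_indicator_le hα A U N ω
  rw [integral_indicator_const _ hT, smul_eq_mul, mul_comm, integral_add'
    (integrable_finsetSum _ integrable_slr) ((integrable_finsetSum _ integrable_lr).div_const α),
    integral_div, integral_finsetSum _ integrable_slr, integral_finsetSum _ integrable_lr] at mono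
  simp only [hp.integral_indicator_lr] at mono
  calc _ ≤ _ := mono
    _ ≤ ∑ i ∈ U, ((∫ ω, count (stopped p.R p.T) i N ω ∂𝓜.P A) * 𝓜.info A i + 1) + 2 ^ k := by
        exact add_le_add (Finset.sum_le_sum fun i _ =>
          (hpred i).integral_slr_add_exp_neg_le A N) ((div_le_iff₀ hα).2 changed)
    _ = _ := by rw [Finset.sum_add_distrib, Finset.sum_const, hU, nsmul_one, add_assoc]

theorem IsPolicy.measurable_T_toENNReal (hp : 𝓜.IsPolicy p) :
    Measurable fun ω => (p.T ω : ℝ≥0∞) :=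
  (measurable_of_countable _).comp hp.measurable_T

theorem IsPolicy.one_le_expT (hp : 𝓜.IsPolicy p) (A : Finset (Fin M)) : 1 ≤ 𝓜.expT A p.T :=
  calc (1 : ℝ≥0∞) = ∫⁻ _, 1 ∂𝓜.P A := by simp
    _ ≤ 𝓜.expT A p.T := lintegral_mono fun ω => by simpa using ENat.toENNReal_le.2 (hp.2.1 ω)

theorem IsPolicy.ae_T_ne_top (hp : 𝓜.IsPolicy p) {A : Finset (Fin M)}
    (hfin : 𝓜.expT A p.T ≠ ⊤) : ∀ᵐ ω ∂𝓜.P A, p.T ω ≠ ⊤ := by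
  filter_upwards [ae_lt_top hp.measurable_T_toENNReal hfin] with ω hω hT
  simp [hT] at hω

theorem IsPolicy.integral_le_mul_expT (hp : 𝓜.IsPolicy p) {A : Finset (Fin M)}
    (hfin : 𝓜.expT A p.T ≠ ⊤) {f : Ω → ℝ} (hf : Integrable f (𝓜.P A)) {a : ℝ}
    (h : ∀ᵐ ω ∂𝓜.P A, ∀ n : ℕ, p.T ω = n → f ω ≤ a * n) :
    ∫ ω, f ω ∂𝓜.P A ≤ a * (𝓜.expT A p.T).toReal := by
  rw [expT, ← integral_toReal hp.measurable_T_toENNReal.aemeasurable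
    (ae_lt_top hp.measurable_T_toENNReal hfin), ← integral_const_mul]
  refine integral_mono_ae hf ((integrable_toReal_of_lintegral_ne_top
    hp.measurable_T_toENNReal.aemeasurable hfin).const_mul a) ?_
  filter_upwards [h, hp.ae_T_ne_top hfin] with ω hω hT
  obtain ⟨n, hn⟩ := ENat.ne_top_iff_exists.1 hT
  simpa [← hn] using hω n hn.symm

theorem IsPolicy.expected_counts_mem_allocSet (hp : 𝓜.IsPolicy p) {K : ℝ}
    (hs : 𝓜.SamplingConstraint K p) {A : Finset (Fin M)} (hfin : 𝓜.expT A p.T ≠ ⊤) (N : ℕ) :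
    (fun i => (∫ ω, count (stopped p.R p.T) i N ω ∂𝓜.P A) / (𝓜.expT A p.T).toReal) ∈
      allocSet M K := by
  have hint := fun i => (hp.samplesPredictably_stopped i).integrable_count A N
  have hpos : 0 < (𝓜.expT A p.T).toReal :=
    ENNReal.toReal_pos (one_pos.trans_le (hp.one_le_expT A)).ne' hfin
  refine ⟨fun i => ⟨div_nonneg (integral_nonneg fun ω => count_nonneg i N ω) hpos.le, ?_⟩, ?_⟩
  · rw [div_le_one hpos, ← one_mul (𝓜.expT A p.T).toReal]
    refine hp.integral_le_mul_expT hfin (hint i) (Eventually.of_forall fun ω n hn => ?_)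
    rw [one_mul]
    exact (count_stopped_le hn i N).trans (count_le i n ω)
  · rw [← Finset.sum_div, div_le_iff₀ hpos, ← integral_finsetSum _ fun i _ => hint i]
    refine hp.integral_le_mul_expT hfin (integrable_finsetSum _ fun i _ => hint i) ?_
    filter_upwards [hs A] with ω hω n hn
    have hn0 : (0 : ℝ) < n := by
      have h1 := hp.2.1 ω
      rw [hn] at h1
      exact_mod_cast h1
    have hK := hω n hn
    rw [div_le_iff₀ hn0, ← sum_count] at hK
    exact (Finset.sum_le_sum fun i _ => count_stopped_le hn i N).trans hK

theorem neg_log_le_optValue_mul_expT {α : ℝ} (hα : 0 < α) {k : ℕ} (hkM : k ≤ M) {K : ℝ}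
    (hp : p ∈ 𝓜.policyClass α k K) {A : Finset (Fin M)} (hfin : 𝓜.expT A p.T ≠ ⊤) :
    -Real.log α ≤
      optValue k K (𝓜.info A) * (𝓜.expT A p.T).toReal + (k + 2 ^ k) := by
  obtain ⟨hpol, hs, herr⟩ := hp
  have hpos : 0 < (𝓜.expT A p.T).toReal :=
    ENNReal.toReal_pos (one_pos.trans_le (hpol.one_le_expT A)).ne' hfin
  have truncated (N : ℕ) : -Real.log α * (𝓜.P A).real {ω | p.T ω ≤ N} ≤
      optValue k K (𝓜.info A) * (𝓜.expT A p.T).toReal + (k + 2 ^ k) := by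
    have hc := hpol.expected_counts_mem_allocSet hs hfin N
    obtain ⟨U, hU, hmin⟩ := exists_minSum_eq hkM (𝓜.info A)
      fun i => (∫ ω, count (stopped p.R p.T) i N ω ∂𝓜.P A) / (𝓜.expT A p.T).toReal
    refine (hpol.neg_log_mul_measure_le hα herr A hU N).trans (add_le_add_left ?_ _)
    rw [← div_le_iff₀ hpos, Finset.sum_div]
    simp only [mul_div_right_comm]
    exact hmin.symm.trans_le (minSum_le_optValue hkM hc)
  have full : 𝓜.P A {ω | p.T ω ≠ ⊤} = 1 :=
    (mem_ae_iff_prob_eq_one (hpol.measurable_T (measurableSet_singleton ⊤).compl)).1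
      (hpol.ae_T_ne_top hfin)
  have limit := (ENNReal.tendsto_toReal (measure_ne_top _ _)).comp
    (tendsto_measure_le_natCast_and (𝓜.P A) p.T fun _ => True)
  simp only [and_true] at limit
  rw [full] at limit
  simpa using le_of_tendsto' (limit.const_mul (-Real.log α)) truncated

theorem ofReal_le_optTime {α : ℝ} (hα : 0 < α) {k : ℕ} (hkM : k ≤ M) {K : ℝ}
    {A : Finset (Fin M)} (hV : 0 < optValue k K (𝓜.info A)) :
    ENNReal.ofReal ((-Real.log α - (k + 2 ^ k)) / optValue k K (𝓜.info A)) ≤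
      𝓜.optTime A α k K := by
  refine le_iInf₂ fun p hp => ?_
  by_cases hfin : 𝓜.expT A p.T = ⊤
  · exact hfin ▸ le_top
  · refine ENNReal.ofReal_le_of_le_toReal ((div_le_iff₀' hV).2 ?_)
    linarith [neg_log_le_optValue_mul_expT hα hkM hp hfin]

end LowerBound

end Model

/-! ### The sum-intersection rule -/

theorem sInf_image_natCast_eq_iff_isLeast {s : Set ℕ} {n : ℕ} :
    sInf ((fun m : ℕ => (m : ℕ∞)) '' s) = n ↔ IsLeast s n := by
  refine ⟨fun h => ?_, fun h => (Nat.mono_cast.map_isLeast h).csInf_eq⟩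
  have hne : ((fun m : ℕ => (m : ℕ∞)) '' s).Nonempty := by
    rw [Set.nonempty_iff_ne_empty]
    intro hempty
    rw [hempty, sInf_empty] at h
    exact ENat.natCast_ne_top n h.symm
  obtain ⟨m, hm, hmn⟩ := csInf_mem hne
  obtain rfl : m = n := Nat.cast_injective (R := ℕ∞) (hmn.trans h)
  exact ⟨hm, fun j hj => by exact_mod_cast h.symm.trans_le (sInf_le (Set.mem_image_of_mem _ hj))⟩

theorem choose_mul_exp_neg_threshold {M k : ℕ} (hkM : k ≤ M) {α : ℝ} (h0 : 0 < α) (h1 : α < 1) :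
    M.choose k * Real.exp (-threshold M k α) = α := by
  have hc : (0 : ℝ) < M.choose k := by exact_mod_cast Nat.choose_pos hkM
  rw [threshold, abs_of_neg (Real.log_neg h0 h1), neg_add, neg_neg, Real.exp_add, Real.exp_neg,
    Real.exp_log h0, Real.exp_log hc]
  field_simp

namespace Model

section SumIntersection

variable {M : ℕ} {S Ω : Type*} [MeasurableSpace S] [MeasurableSpace Ω] {𝓜 : Model M S Ω}
  {R : ℕ → Ω → Finset (Fin M)} {k : ℕ}

variable (𝓜) in
/-- The stopping criterion of the sum-intersection rule at time `n`, stated without sorting: the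
sum of the `k` smallest numbers is at least `d` if and only if every sum of `k` of them is. -/
def SiCross (R : ℕ → Ω → Finset (Fin M)) (k : ℕ) (d : ℝ) (n : ℕ) (ω : Ω) : Prop :=
  ∀ U : Finset (Fin M), U.card = k → d ≤ ∑ i ∈ U, |𝓜.llr R i n ω|

theorem siTime_eq_sInf (hkM : k ≤ M) (d : ℝ) (ω : Ω) :
    𝓜.siTime R k d ω =
      sInf ((fun n : ℕ => (n : ℕ∞)) '' {n : ℕ | 1 ≤ n ∧ 𝓜.SiCross R k d n ω}) := by
  unfold siTime sortedAbsLLR SiCross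
  simp only [le_sum_initial_sort_iff _ hkM]

theorem siTime_eq_natCast_iff (hkM : k ≤ M) {d : ℝ} {ω : Ω} {n : ℕ} :
    𝓜.siTime R k d ω = n ↔ IsLeast {n : ℕ | 1 ≤ n ∧ 𝓜.SiCross R k d n ω} n := by
  rw [siTime_eq_sInf hkM, sInf_image_natCast_eq_iff_isLeast]

theorem siTime_le (hkM : k ≤ M) {d : ℝ} {ω : Ω} {n : ℕ} (hn : 1 ≤ n)
    (h : 𝓜.SiCross R k d n ω) : 𝓜.siTime R k d ω ≤ n := by
  rw [siTime_eq_sInf hkM]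
  exact sInf_le ⟨n, ⟨hn, h⟩, rfl⟩

theorem one_le_siTime (d : ℝ) (ω : Ω) : 1 ≤ 𝓜.siTime R k d ω := by
  refine le_sInf ?_
  rintro _ ⟨n, ⟨hn, -⟩, rfl⟩
  exact Nat.one_le_cast.2 hn

theorem mem_siDecision_iff {d : ℝ} {ω : Ω} {n : ℕ} (hn : 𝓜.siTime R k d ω = n) (i : Fin M) :
    i ∈ 𝓜.siDecision R k d ω ↔ 0 < 𝓜.llr R i n ω := by
  simp [siDecision, hn]

theorem IsSamplingRule.measurableSet_siCross (hR : 𝓜.IsSamplingRule R) (d : ℝ) (n : ℕ) :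
    MeasurableSet[𝓜.filt R n] {ω | 𝓜.SiCross R k d n ω} := by
  simp only [SiCross, Set.ofPred_forall]
  refine MeasurableSet.iInter fun U => MeasurableSet.iInter fun _ => ?_
  have hsum : Measurable[𝓜.filt R n] fun ω => ∑ i ∈ U, |𝓜.llr R i n ω| :=
    U.measurable_sum fun i _ => measurable_abs.comp (hR.measurable_llr i n)
  exact hsum measurableSet_Ici

theorem IsSamplingRule.measurableSet_siTime (hR : 𝓜.IsSamplingRule R) (hkM : k ≤ M)
    (d : ℝ) (n : ℕ) : MeasurableSet[𝓜.filt R n] {ω | 𝓜.siTime R k d ω = n} := by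
  have hset : {ω | 𝓜.siTime R k d ω = n} = ({_ω | 1 ≤ n} ∩ {ω | 𝓜.SiCross R k d n ω}) ∩
      ⋂ m, ⋂ (_ : m < n), ⋂ (_ : 1 ≤ m), {ω | 𝓜.SiCross R k d m ω}ᶜ := by
    ext ω
    simp only [Set.mem_ofPred_eq, siTime_eq_natCast_iff hkM, IsLeast, lowerBounds,
      Set.mem_inter_iff, Set.mem_iInter, Set.mem_compl_iff]
    exact and_congr_right fun _ => ⟨fun h m hmn hm hc => hmn.not_ge (h ⟨hm, hc⟩),
      fun h m hm => not_lt.1 fun hmn => h m hmn hm.1 hm.2⟩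
  rw [hset]
  refine ((MeasurableSet.const _).inter (hR.measurableSet_siCross d n)).inter
    (MeasurableSet.iInter fun m => MeasurableSet.iInter fun hm => MeasurableSet.iInter fun _ => ?_)
  exact filt_mono 𝓜 R hm.le _ (hR.measurableSet_siCross d m).compl

theorem IsSamplingRule.measurableSet_siTime_siDecision (hR : 𝓜.IsSamplingRule R)
    (hkM : k ≤ M) (d : ℝ) (n : ℕ) (D : Finset (Fin M)) :
    MeasurableSet[𝓜.filt R n] {ω | 𝓜.siTime R k d ω = n ∧ 𝓜.siDecision R k d ω = D} := by
  have hset : {ω | 𝓜.siTime R k d ω = n ∧ 𝓜.siDecision R k d ω = D} =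
      {ω | 𝓜.siTime R k d ω = n} ∩ ⋂ i, {ω | 0 < 𝓜.llr R i n ω ↔ i ∈ D} := by
    ext ω
    simp only [Set.mem_ofPred_eq, Set.mem_inter_iff, Set.mem_iInter, Finset.ext_iff]
    exact and_congr_right fun hn => by simp only [mem_siDecision_iff hn]
  rw [hset]
  refine (hR.measurableSet_siTime hkM d n).inter (MeasurableSet.iInter fun i => ?_)
  have hpos : MeasurableSet[𝓜.filt R n] {ω | 0 < 𝓜.llr R i n ω} :=
    hR.measurable_llr i n measurableSet_Ioi
  by_cases hi : i ∈ D
  · simpa only [hi, iff_true] using hpos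
  · simp only [hi, iff_false]
    exact hpos.compl

theorem IsSamplingRule.isPolicy_siPolicy (hR : 𝓜.IsSamplingRule R) (hkM : k ≤ M) (d : ℝ) :
    𝓜.IsPolicy (𝓜.siPolicy R k d) :=
  ⟨hR, one_le_siTime d, fun n _ => hR.measurableSet_siTime hkM d n,
    fun n _ => hR.measurableSet_siTime_siDecision hkM d n⟩

theorem slr_eq_neg_abs_of_mem_symmDiff {B : Finset (Fin M)} {d : ℝ} {ω : Ω} {n : ℕ}
    (hn : 𝓜.siTime R k d ω = n) {i : Fin M} (hi : i ∈ symmDiff B (𝓜.siDecision R k d ω)) :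
    𝓜.slr B R i n ω = -|𝓜.llr R i n ω| := by
  rw [Finset.mem_symmDiff, mem_siDecision_iff hn] at hi
  rw [slr_eq_ite_llr]
  rcases hi with ⟨hB, hneg⟩ | ⟨hpos, hB⟩
  · rw [if_pos hB, abs_of_nonpos (not_lt.1 hneg), neg_neg]
  · rw [if_neg hB, abs_of_pos hpos]

theorem exp_le_lr_stopped_siTime (hkM : k ≤ M) {d : ℝ} {B U : Finset (Fin M)} (hU : U.card = k)
    {N : ℕ} {ω : Ω} (hT : 𝓜.siTime R k d ω ≤ N)
    (herr : U ⊆ symmDiff B (𝓜.siDecision R k d ω)) :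
    ENNReal.ofReal (Real.exp d) ≤ 𝓜.lr B U (stopped R (𝓜.siTime R k d)) N ω := by
  obtain ⟨n, hn⟩ := ENat.ne_top_iff_exists.1 (ne_top_of_le_ne_top (ENat.natCast_ne_top N) hT)
  have hnN : n ≤ N := by exact_mod_cast hn.trans_le hT
  have cross := ((siTime_eq_natCast_iff hkM).1 hn.symm).1.2 U hU
  refine ENNReal.ofReal_le_ofReal (Real.exp_le_exp.2 (cross.trans_eq ?_))
  rw [← Finset.sum_neg_distrib]
  refine Finset.sum_congr rfl fun i hi => ?_
  exact (neg_eq_iff_eq_neg.2 ((slr_stopped (p := 𝓜.siPolicy R k d) B hn.symm hnN).trans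
    (slr_eq_neg_abs_of_mem_symmDiff hn.symm (herr hi)))).symm

theorem IsSamplingRule.measure_siDecision_error_le (hR : 𝓜.IsSamplingRule R) (hkM : k ≤ M)
    (d : ℝ) (B : Finset (Fin M)) {U : Finset (Fin M)} (hU : U.card = k) :
    𝓜.P B {ω | 𝓜.siTime R k d ω ≠ ⊤ ∧ U ⊆ symmDiff B (𝓜.siDecision R k d ω)} ≤
      ENNReal.ofReal (Real.exp (-d)) := by
  have hp := hR.isPolicy_siPolicy hkM d
  refine le_of_tendsto' (tendsto_measure_le_natCast_and (𝓜.P B) (𝓜.siTime R k d) fun ω =>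
    U ⊆ symmDiff B (𝓜.siDecision R k d ω)) fun N => ?_
  have hE := hp.measurableSet_T_le_and N fun D => U ⊆ symmDiff B D
  have scaled := calc
    ENNReal.ofReal (Real.exp d) *
        𝓜.P B {ω | 𝓜.siTime R k d ω ≤ N ∧ U ⊆ symmDiff B (𝓜.siDecision R k d ω)} =
        ∫⁻ _ in {ω | 𝓜.siTime R k d ω ≤ N ∧ U ⊆ symmDiff B (𝓜.siDecision R k d ω)},
          ENNReal.ofReal (Real.exp d) ∂𝓜.P B := (setLIntegral_const _ _).symm
    _ ≤ ∫⁻ ω in {ω | 𝓜.siTime R k d ω ≤ N ∧ U ⊆ symmDiff B (𝓜.siDecision R k d ω)},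
          𝓜.lr B U (stopped R (𝓜.siTime R k d)) N ω ∂𝓜.P B :=
        setLIntegral_mono' hE fun ω hω => exp_le_lr_stopped_siTime hkM hU hω.1 hω.2
    _ = 𝓜.P (symmDiff B U) _ := hp.setLIntegral_lr_stopped B U N fun D => U ⊆ symmDiff B D
    _ ≤ 1 := prob_le_one
  rw [Real.exp_neg, ENNReal.ofReal_inv_of_pos (Real.exp_pos d)]
  exact ENNReal.le_inv_iff_mul_le.2 ((mul_comm _ _).trans_le scaled)

theorem IsSamplingRule.errorConstraint_siPolicy (hR : 𝓜.IsSamplingRule R) (hkM : k ≤ M)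
    {α : ℝ} (h0 : 0 < α) (h1 : α < 1) :
    𝓜.ErrorConstraint α k (𝓜.siPolicy R k (threshold M k α)) := by
  intro B
  set d := threshold M k α with hd
  have cover : {ω | (𝓜.siPolicy R k d).T ω ≠ ⊤ ∧
      k ≤ (symmDiff B ((𝓜.siPolicy R k d).Δ ω)).card} ⊆
      ⋃ U ∈ Finset.powersetCard k (Finset.univ : Finset (Fin M)),
        {ω | 𝓜.siTime R k d ω ≠ ⊤ ∧ U ⊆ symmDiff B (𝓜.siDecision R k d ω)} := by
    rintro ω ⟨hT, hc⟩
    obtain ⟨U, hU, hUc⟩ := Finset.exists_subset_card_eq hc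
    simp only [Set.mem_iUnion, Finset.mem_powersetCard, exists_prop]
    exact ⟨U, ⟨Finset.subset_univ _, hUc⟩, hT, hU⟩
  calc _ ≤ _ := (measure_mono cover).trans (measure_biUnion_finset_le _ _)
    _ ≤ ∑ _U ∈ Finset.powersetCard k (Finset.univ : Finset (Fin M)),
        ENNReal.ofReal (Real.exp (-d)) := Finset.sum_le_sum fun _ hU =>
          hR.measure_siDecision_error_le hkM d B (Finset.mem_powersetCard.1 hU).2
    _ = ENNReal.ofReal α := by
        rw [Finset.sum_const, Finset.card_powersetCard, Finset.card_univ, Fintype.card_fin,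
          nsmul_eq_mul, ← ENNReal.ofReal_natCast, ← ENNReal.ofReal_mul (Nat.cast_nonneg _), hd,
          choose_mul_exp_neg_threshold hkM h0 h1]

end SumIntersection

end Model

/-! ### The expected time of the sum-intersection rule -/

theorem exists_lt_exists_mem_Ico_le_mul {c f v : ℝ} (hf : 0 < f) (hv : v < c * f) :
    ∃ ρ < c, ∃ a ∈ Set.Ico 0 f, v ≤ ρ * a := by
  obtain ⟨ρ, hvρ, hρc⟩ := exists_between ((div_lt_iff₀ hf).2 hv)
  refine ⟨ρ, hρc, ?_⟩
  rcases le_or_gt v 0 with hv0 | hv0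
  · exact ⟨0, ⟨le_rfl, hf⟩, by rwa [mul_zero]⟩
  · have hρ : 0 < ρ := (div_pos hv0 hf).trans hvρ
    exact ⟨v / ρ, ⟨(div_pos hv0 hρ).le, (div_lt_comm₀ hf hρ).1 hvρ⟩,
      (mul_div_cancel₀ v hρ.ne').ge⟩

theorem toENNReal_le_add_tsum (T : ℕ∞) (n₀ : ℕ) :
    (T : ℝ≥0∞) ≤ n₀ + ∑' j : ℕ, if ((n₀ + j : ℕ) : ℕ∞) < T then (1 : ℝ≥0∞) else 0 := by
  induction T using ENat.recTopCoe with
  | top =>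
    simp only [ENat.natCast_lt_top, if_true, ENNReal.tsum_const_eq_top_of_ne_zero one_ne_zero,
      add_top, le_top]
  | coe n =>
    have partialSum : ((n - n₀ : ℕ) : ℝ≥0∞) ≤
        ∑' j : ℕ, if ((n₀ + j : ℕ) : ℕ∞) < (n : ℕ∞) then (1 : ℝ≥0∞) else 0 :=
      calc ((n - n₀ : ℕ) : ℝ≥0∞) = ∑ _j ∈ Finset.range (n - n₀), (1 : ℝ≥0∞) := by simp
        _ = ∑ j ∈ Finset.range (n - n₀),
            if ((n₀ + j : ℕ) : ℕ∞) < (n : ℕ∞) then (1 : ℝ≥0∞) else 0 :=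
          Finset.sum_congr rfl fun j hj => by
            have hlt : n₀ + j < n := by have := Finset.mem_range.1 hj; omega
            rw [if_pos (by exact_mod_cast hlt)]
        _ ≤ _ := ENNReal.sum_le_tsum _
    refine le_trans ?_ (add_le_add_right partialSum _)
    rw [ENat.toENNReal_coe, ← Nat.cast_add]
    exact Nat.cast_le.2 (by omega)

theorem lintegral_toENNReal_le_add_tsum_measure {Ω : Type*} [MeasurableSpace Ω] {μ : Measure Ω}
    [IsProbabilityMeasure μ] {T : Ω → ℕ∞} {E : ℕ → Set Ω} (hE : ∀ n, MeasurableSet (E n))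
    {n₀ : ℕ} (hT : ∀ n ≥ n₀, ∀ ω, (n : ℕ∞) < T ω → ω ∈ E n) :
    ∫⁻ ω, (T ω : ℝ≥0∞) ∂μ ≤ n₀ + ∑' n, μ (E n) := by
  have pointwise (ω : Ω) :
      (T ω : ℝ≥0∞) ≤ n₀ + ∑' j, (E (n₀ + j)).indicator (1 : Ω → ℝ≥0∞) ω := by
    refine (toENNReal_le_add_tsum (T ω) n₀).trans
      (add_le_add_right (ENNReal.tsum_le_tsum fun j => ?_) _)
    split_ifs with hj
    · rw [Set.indicator_of_mem (hT _ (Nat.le_add_right n₀ j) ω hj), Pi.one_apply]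
    · exact zero_le
  calc ∫⁻ ω, (T ω : ℝ≥0∞) ∂μ
      ≤ ∫⁻ ω, (n₀ + ∑' j, (E (n₀ + j)).indicator (1 : Ω → ℝ≥0∞) ω) ∂μ := lintegral_mono pointwise
    _ = n₀ + ∑' j, μ (E (n₀ + j)) := by
        rw [lintegral_add_left measurable_const, lintegral_const, measure_univ, mul_one,
          lintegral_tsum fun j => (measurable_one.indicator (hE _)).aemeasurable]
        simp only [lintegral_indicator_one (hE _)]
    _ ≤ n₀ + ∑' n, μ (E n) := add_le_add_right
        (ENNReal.tsum_comp_le_tsum_of_injective (add_right_injective n₀) fun n => μ (E n)) _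

namespace Model

section UpperBound

variable {M : ℕ} {S Ω : Type*} [MeasurableSpace S] [MeasurableSpace Ω] {𝓜 : Model M S Ω}
  {R : ℕ → Ω → Finset (Fin M)}

theorem setOf_abs_llr_lt_subset (A : Finset (Fin M)) (i : Fin M) (n : ℕ) {a : ℝ} (ha : 0 ≤ a)
    (ρ : ℝ) :
    {ω | |𝓜.llr R i n ω| < n * (ρ * a)} ⊆ {ω | freq R i n ω < ρ} ∪
      {ω | ρ * n ≤ count R i n ω ∧ 𝓜.slr A R i n ω ≤ a * count R i n ω} := by
  intro ω hω
  rcases n.eq_zero_or_pos with rfl | hn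
  · simp only [Nat.cast_zero, zero_mul, Set.mem_ofPred_eq] at hω
    exact absurd hω (abs_nonneg _).not_gt
  refine or_iff_not_imp_left.2 fun hfreq => ?_
  have hcount : ρ * n ≤ count R i n ω := by
    rwa [Set.mem_ofPred_eq, not_lt, freq_eq_count_div, le_div_iff₀ (by exact_mod_cast hn)] at hfreq
  refine ⟨hcount, ?_⟩
  calc 𝓜.slr A R i n ω ≤ |𝓜.llr R i n ω| := (le_abs_self _).trans_eq (abs_slr A i n ω)
    _ ≤ a * (ρ * n) := hω.le.trans_eq (by ring)
    _ ≤ a * count R i n ω := mul_le_mul_of_nonneg_left hcount ha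

theorem SamplesPredictably.tsum_measure_abs_llr_lt_mul_ne_top {i : Fin M}
    (hR : 𝓜.SamplesPredictably R i) (A : Finset (Fin M)) {ρ a : ℝ}
    (ha : a ∈ Set.Ico 0 (𝓜.info A i))
    (hfreq : Summable fun n : ℕ => (𝓜.P A).real {ω | freq R i n ω < ρ}) :
    ∑' n : ℕ, 𝓜.P A {ω | |𝓜.llr R i n ω| < n * (ρ * a)} ≠ ⊤ := by
  rcases le_or_gt ρ 0 with hρ | hρ
  · have hempty (n : ℕ) : {ω | |𝓜.llr R i n ω| < n * (ρ * a)} = ∅ :=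
      Set.eq_empty_of_forall_notMem fun ω hω => (abs_nonneg _).not_gt (lt_of_lt_of_le hω
        (mul_nonpos_of_nonneg_of_nonpos n.cast_nonneg (mul_nonpos_of_nonpos_of_nonneg hρ ha.1)))
    simp [hempty]
  obtain ⟨b, hb, deviation⟩ := hR.exists_measure_slr_le_exp A hρ ha.2
  have rare : ∑' n, 𝓜.P A {ω | freq R i n ω < ρ} ≠ ⊤ := by
    simpa only [ofReal_measureReal (measure_ne_top _ _)] using hfreq.tsum_ofReal_ne_top
  have geometric : Summable fun n : ℕ => Real.exp (-(b * n)) :=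
    (Real.summable_exp_nat_mul_iff.2 (neg_lt_zero.2 hb)).congr fun n => by ring_nf
  refine ne_top_of_le_ne_top (ENNReal.add_ne_top.2 ⟨rare, geometric.tsum_ofReal_ne_top⟩) ?_
  rw [← ENNReal.tsum_add]
  exact ENNReal.tsum_le_tsum fun n => (measure_mono (setOf_abs_llr_lt_subset A i n ha.1 ρ)).trans
    ((measure_union_le _ _).trans (add_le_add_right (deviation n) _))

theorem SamplesPredictably.tsum_measure_abs_llr_lt_ne_top {i : Fin M}
    (hR : 𝓜.SamplesPredictably R i) (A : Finset (Fin M)) {c : ℝ}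
    (hfreq : ∀ ε > 0, Summable fun n : ℕ => (𝓜.P A).real {ω | freq R i n ω < c - ε})
    {v : ℝ} (hv : v < c * 𝓜.info A i) :
    ∑' n : ℕ, 𝓜.P A {ω | |𝓜.llr R i n ω| < n * v} ≠ ⊤ := by
  obtain ⟨ρ, hρ, a, ha, hva⟩ := exists_lt_exists_mem_Ico_le_mul (𝓜.info_pos A i) hv
  have hfreqρ := hfreq (c - ρ) (sub_pos.2 hρ)
  rw [sub_sub_cancel] at hfreqρ
  refine ne_top_of_le_ne_top (hR.tsum_measure_abs_llr_lt_mul_ne_top A ha hfreqρ)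
    (ENNReal.tsum_le_tsum fun n => measure_mono fun ω hω => ?_)
  exact lt_of_lt_of_le hω (mul_le_mul_of_nonneg_left hva n.cast_nonneg)

theorem exists_abs_llr_lt_of_lt_siTime {k : ℕ} (hkM : k ≤ M) {v : Fin M → ℝ} {V d : ℝ}
    (hV : ∀ U : Finset (Fin M), U.card = k → V ≤ ∑ i ∈ U, v i) {n : ℕ} (hn : 1 ≤ n)
    (hd : d ≤ n * V) {ω : Ω} (hT : n < 𝓜.siTime R k d ω) : ∃ i, |𝓜.llr R i n ω| < n * v i := by
  have notCross : ¬𝓜.SiCross R k d n ω := fun h => (siTime_le hkM hn h).not_gt hT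
  unfold SiCross at notCross
  push Not at notCross
  obtain ⟨U, hU, hlt⟩ := notCross
  have hsum : ∑ i ∈ U, |𝓜.llr R i n ω| < ∑ i ∈ U, n * v i := by
    rw [← Finset.mul_sum]
    exact hlt.trans_le (hd.trans (mul_le_mul_of_nonneg_left (hV U hU) n.cast_nonneg))
  obtain ⟨i, -, hi⟩ := Finset.exists_lt_of_sum_lt hsum
  exact ⟨i, hi⟩

theorem IsSamplingRule.exists_expT_siTime_le (hR : 𝓜.IsSamplingRule R) {k : ℕ} (hkM : k ≤ M)
    (A : Finset (Fin M)) {v : Fin M → ℝ} {V : ℝ} (hV0 : 0 < V)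
    (hV : ∀ U : Finset (Fin M), U.card = k → V ≤ ∑ i ∈ U, v i)
    (hv : ∀ i, ∑' n : ℕ, 𝓜.P A {ω | |𝓜.llr R i n ω| < n * v i} ≠ ⊤) :
    ∃ C : ℝ, ∀ d > 0, 𝓜.expT A (𝓜.siTime R k d) ≤ ENNReal.ofReal (d / V + C) := by
  let E (i : Fin M) (n : ℕ) : Set Ω := {ω | |𝓜.llr R i n ω| < n * v i}
  have measurable_E (i : Fin M) (n : ℕ) : MeasurableSet (E i n) :=
    measurableSet_lt (measurable_abs.comp
      ((hR.measurable_llr i n).mono (hR.filt_le n) le_rfl)) measurable_const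
  let B : ℝ≥0∞ := ∑ i, ∑' n, 𝓜.P A (E i n)
  have hB : B ≠ ⊤ := ENNReal.sum_ne_top.2 fun i _ => hv i
  refine ⟨1 + B.toReal, fun d hd => ?_⟩
  have cover (n : ℕ) (hn : n ≥ ⌈d / V⌉₊) (ω : Ω) (hT : n < 𝓜.siTime R k d ω) :
      ω ∈ ⋃ i, E i n := Set.mem_iUnion.2 <|
    exists_abs_llr_lt_of_lt_siTime hkM hV ((Nat.one_le_ceil_iff.2 (div_pos hd hV0)).trans hn)
      ((div_le_iff₀ hV0).1 (Nat.ceil_le.1 hn)) hT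
  calc 𝓜.expT A (𝓜.siTime R k d)
      ≤ ⌈d / V⌉₊ + ∑' n, 𝓜.P A (⋃ i, E i n) :=
        lintegral_toENNReal_le_add_tsum_measure
          (fun n => MeasurableSet.iUnion fun i => measurable_E i n) cover
    _ ≤ ⌈d / V⌉₊ + B := add_le_add_right ((ENNReal.tsum_le_tsum fun n =>
          measure_iUnion_fintype_le (𝓜.P A) fun i => E i n).trans_eq
            (Summable.tsum_finsetSum fun i _ => ENNReal.summable)) _
    _ = ENNReal.ofReal (⌈d / V⌉₊ + B.toReal) := by
        rw [ENNReal.ofReal_add (Nat.cast_nonneg _) ENNReal.toReal_nonneg,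
          ENNReal.ofReal_natCast, ENNReal.ofReal_toReal hB]
    _ ≤ ENNReal.ofReal (d / V + (1 + B.toReal)) := by
        refine ENNReal.ofReal_le_ofReal ?_
        linarith [Nat.ceil_lt_add_one (div_pos hd hV0).le]

end UpperBound

end Model

/-! ### Asymptotic equivalence -/

theorem tendsto_ofReal_div_ofReal {ι : Type*} {f g : ι → ℝ} {l : Filter ι} {a : ℝ}
    (hg : ∀ᶠ x in l, 0 < g x) (h : Tendsto (fun x => f x / g x) l (𝓝 a)) :
    Tendsto (fun x => ENNReal.ofReal (f x) / ENNReal.ofReal (g x)) l (𝓝 (ENNReal.ofReal a)) :=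
  ((ENNReal.continuous_ofReal.tendsto a).comp h).congr'
    (hg.mono fun _ hx => ENNReal.ofReal_div_of_pos hx)

theorem eventually_mem_Ioo_nhdsGT_zero : ∀ᶠ α in 𝓝[>] (0 : ℝ), 0 < α ∧ α < 1 :=
  Ioo_mem_nhdsGT one_pos

theorem tendsto_abs_log_nhdsGT_zero : Tendsto (fun α => |Real.log α|) (𝓝[>] 0) atTop :=
  tendsto_abs_atBot_atTop.comp Real.tendsto_log_nhdsGT_zero

theorem eventually_abs_log_div_pos {V : ℝ} (hV : 0 < V) :
    ∀ᶠ α in 𝓝[>] (0 : ℝ), 0 < |Real.log α| / V :=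
  (tendsto_abs_log_nhdsGT_zero.eventually_gt_atTop 0).mono fun _ h => div_pos h hV

theorem tendsto_ofReal_affine_abs_log_div {V V' : ℝ} (hV : 0 < V) (hV' : 0 < V') (b C : ℝ) :
    Tendsto (fun α => ENNReal.ofReal ((|Real.log α| + b) / V' + C) /
      ENNReal.ofReal (|Real.log α| / V)) (𝓝[>] 0) (𝓝 (ENNReal.ofReal (V / V'))) := by
  refine tendsto_ofReal_div_ofReal (eventually_abs_log_div_pos hV) ?_
  have vanish := (tendsto_abs_log_nhdsGT_zero.const_div_atTop ((b / V' + C) * V)).const_add (V / V')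
  rw [add_zero] at vanish
  refine vanish.congr' ?_
  filter_upwards [tendsto_abs_log_nhdsGT_zero.eventually_gt_atTop 0] with α hα
  field_simp
  ring

theorem tendsto_ofReal_div_self_nhdsLT {V : ℝ} (hV : 0 < V) :
    Tendsto (fun V' => ENNReal.ofReal (V / V')) (𝓝[<] V) (𝓝 1) := by
  have h : Tendsto (fun V' : ℝ => V / V') (𝓝[<] V) (𝓝 (V / V)) :=
    (tendsto_const_nhds.div tendsto_id hV.ne').mono_left nhdsWithin_le_nhds
  rw [div_self hV.ne'] at h
  simpa only [ENNReal.ofReal_one, Function.comp_def] using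
    (ENNReal.continuous_ofReal.tendsto 1).comp h

theorem asympEquiv_abs_log_div_of_bounds {x : ℝ → ℝ≥0∞} {V b c : ℝ} (hV : 0 < V)
    (hlow : ∀ᶠ α in 𝓝[>] (0 : ℝ), ENNReal.ofReal ((|Real.log α| - c) / V) ≤ x α)
    (hup : ∀ V' ∈ Set.Ioo 0 V, ∃ C : ℝ, ∀ᶠ α in 𝓝[>] (0 : ℝ),
      x α ≤ ENNReal.ofReal ((|Real.log α| + b) / V' + C)) :
    AsympEquiv x fun α => ENNReal.ofReal (|Real.log α| / V) := by
  refine tendsto_order.2 ⟨fun a ha => ?_, fun a ha => ?_⟩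
  · have hlim := tendsto_ofReal_affine_abs_log_div hV hV (-c) 0
    rw [div_self hV.ne', ENNReal.ofReal_one] at hlim
    filter_upwards [hlim.eventually (lt_mem_nhds ha), hlow] with α hα hx
    rw [add_zero, ← sub_eq_add_neg] at hα
    exact hα.trans_le (ENNReal.div_le_div_right hx _)
  · obtain ⟨V', hV'a, hV'⟩ := (((tendsto_ofReal_div_self_nhdsLT hV).eventually
      (gt_mem_nhds ha)).and (Ioo_mem_nhdsLT hV)).exists
    obtain ⟨C, hC⟩ := hup V' hV'
    have hlim := tendsto_ofReal_affine_abs_log_div hV hV'.1 b C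
    filter_upwards [hlim.eventually (gt_mem_nhds hV'a), hC] with α hα hx
    exact (ENNReal.div_le_div_right hx _).trans_lt hα

theorem AsympEquiv.div_of_common {x y : ℝ → ℝ≥0∞} {l : ℝ → ℝ}
    (hl : ∀ᶠ α in 𝓝[>] (0 : ℝ), 0 < l α)
    (hx : AsympEquiv x fun α => ENNReal.ofReal (l α))
    (hy : AsympEquiv y fun α => ENNReal.ofReal (l α)) : AsympEquiv x y := by
  have h := ENNReal.Tendsto.div hx (Or.inl one_ne_zero) hy (Or.inl ENNReal.one_ne_top)
  rw [ENNReal.div_self one_ne_zero ENNReal.one_ne_top] at h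
  refine h.congr' ?_
  filter_upwards [hl] with α hα
  exact ENNReal.mul_div_mul_right (x α) (y α) (ENNReal.inv_ne_zero.2 ENNReal.ofReal_ne_top)
    (ENNReal.inv_ne_top.2 (ENNReal.ofReal_pos.2 hα).ne')

namespace Model

section MainTheorem

variable {M : ℕ} {S Ω : Type*} [MeasurableSpace S] [MeasurableSpace Ω] {𝓜 : Model M S Ω}
  {R : ℕ → Ω → Finset (Fin M)} {k : ℕ} {K : ℝ} {A : Finset (Fin M)}

theorem optValue_F : optValue k K (𝓜.F A) = optValue k K (𝓜.info A) :=
  optValue_comp_perm _ _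

theorem isMaximizer_info_of_isMaximizer_F {σ : Equiv.Perm (Fin M)}
    (hσ : Monotone (𝓜.info A ∘ σ)) {c c' : Fin M → ℝ} (hc' : IsMaximizer k K (𝓜.F A) c')
    (hcc' : ∀ i, c (σ i) = c' i) : IsMaximizer k K (𝓜.info A) c := by
  obtain rfl : c ∘ σ = c' := funext hcc'
  rw [F, ← Tuple.comp_sort_eq_comp_iff_monotone.2 hσ] at hc'
  exact (isMaximizer_comp_perm_iff σ).1 hc'

theorem IsSamplingRule.eventually_siPolicy_mem_policyClass (hR : 𝓜.IsSamplingRule R)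
    (hkM : k ≤ M) (hsamp : ∀ᶠ α in 𝓝[>] (0 : ℝ),
      𝓜.SamplingConstraint K (𝓜.siPolicy R k (threshold M k α))) :
    ∀ᶠ α in 𝓝[>] (0 : ℝ), 𝓜.siPolicy R k (threshold M k α) ∈ 𝓜.policyClass α k K := by
  filter_upwards [hsamp, eventually_mem_Ioo_nhdsGT_zero] with α hα h01
  exact ⟨hR.isPolicy_siPolicy hkM _, hα, hR.errorConstraint_siPolicy hkM h01.1 h01.2⟩

theorem eventually_ofReal_le_optTime (hkM : k ≤ M) (hV : 0 < optValue k K (𝓜.info A)) :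
    ∀ᶠ α in 𝓝[>] (0 : ℝ),
      ENNReal.ofReal ((|Real.log α| - (k + 2 ^ k)) / optValue k K (𝓜.info A)) ≤
        𝓜.optTime A α k K := by
  filter_upwards [eventually_mem_Ioo_nhdsGT_zero] with α hα
  rw [abs_of_neg (Real.log_neg hα.1 hα.2)]
  exact ofReal_le_optTime hα.1 hkM hV

theorem IsSamplingRule.exists_eventually_expT_siTime_le (hR : 𝓜.IsSamplingRule R) (hk : 1 ≤ k)
    (hkM : k ≤ M) {c : Fin M → ℝ} (hc : IsMaximizer k K (𝓜.info A) c)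
    (hfreq : ∀ i, ∀ ε > 0,
      Summable fun n : ℕ => (𝓜.P A).real {ω | freq R i (n + 1) ω < c i - ε})
    {V' : ℝ} (hV' : V' ∈ Set.Ioo 0 (optValue k K (𝓜.info A))) :
    ∃ C : ℝ, ∀ᶠ α in 𝓝[>] (0 : ℝ), 𝓜.expT A (𝓜.siTime R k (threshold M k α)) ≤
      ENNReal.ofReal ((|Real.log α| + Real.log (M.choose k)) / V' + C) := by
  have hk0 : (0 : ℝ) < k := by exact_mod_cast hk
  let δ : ℝ := (optValue k K (𝓜.info A) - V') / k
  have hδ : 0 < δ := div_pos (sub_pos.2 hV'.2) hk0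
  have hkδ : k * δ = optValue k K (𝓜.info A) - V' := mul_div_cancel₀ _ hk0.ne'
  have rate (U : Finset (Fin M)) (hU : U.card = k) :
      V' ≤ ∑ i ∈ U, (c i * 𝓜.info A i - δ) := by
    have hmin := minSum_le (𝓜.info A) c hU
    rw [← hc.optValue_eq] at hmin
    rw [Finset.sum_sub_distrib, Finset.sum_const, hU, nsmul_eq_mul, hkδ]
    linarith
  obtain ⟨C, hC⟩ := hR.exists_expT_siTime_le hkM A hV'.1 rate fun i =>
    (hR.samplesPredictably i).tsum_measure_abs_llr_lt_ne_top A
      (fun ε hε => (summable_nat_add_iff 1).1 (hfreq i ε hε)) (sub_lt_self _ hδ)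
  refine ⟨C, ?_⟩
  filter_upwards [tendsto_abs_log_nhdsGT_zero.eventually_gt_atTop 0] with α hα
  have hchoose : (1 : ℝ) ≤ M.choose k := by exact_mod_cast Nat.choose_pos hkM
  exact hC _ (add_pos_of_pos_of_nonneg hα (Real.log_nonneg hchoose))

end MainTheorem

end Model

end AnomalyID

theorem mainTheorem1_general {M : ℕ} {S Ω : Type*} [MeasurableSpace S] [MeasurableSpace Ω]
    (𝓜 : AnomalyID.Model M S Ω)
    (k : ℕ) (hk : 1 ≤ k) (hkM : k ≤ M)
    (K : ℝ) (hK : 0 < K)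
    (A : Finset (Fin M))
    (R : ℕ → Ω → Finset (Fin M)) (hR : 𝓜.IsSamplingRule R)
    (hsamp : ∀ᶠ α in 𝓝[>] (0 : ℝ),
      𝓜.SamplingConstraint K (𝓜.siPolicy R k (AnomalyID.threshold M k α)))
    (c : Fin M → ℝ) (hc : AnomalyID.IsMaximizer k K (𝓜.info A) c)
    (hfreq : ∀ i, ∀ ε > 0,
      Summable fun n : ℕ => (𝓜.P A).real {ω | AnomalyID.freq R i (n + 1) ω < c i - ε}) :
    (∀ᶠ α in 𝓝[>] (0 : ℝ),
      𝓜.siPolicy R k (AnomalyID.threshold M k α) ∈ 𝓜.policyClass α k K) ∧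
    AnomalyID.AsympEquiv
      (fun α => 𝓜.expT A (𝓜.siTime R k (AnomalyID.threshold M k α)))
      (fun α => 𝓜.optTime A α k K) ∧
    AnomalyID.AsympEquiv
      (fun α => 𝓜.optTime A α k K)
      (fun α => ENNReal.ofReal (|Real.log α| / AnomalyID.optValue k K (𝓜.info A))) := by
  have hV := AnomalyID.optValue_pos hk hkM hK (𝓜.info_pos A)
  have admissible := hR.eventually_siPolicy_mem_policyClass hkM hsamp
  have lower := AnomalyID.Model.eventually_ofReal_le_optTime hkM hV
  have upper := fun V' => hR.exists_eventually_expT_siTime_le hk hkM hc hfreq (V' := V')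
  have optTime_le := admissible.mono fun α hα =>
    iInf₂_le (f := fun p _ => 𝓜.expT A p.T) _ hα
  have si_asymp := AnomalyID.asympEquiv_abs_log_div_of_bounds hV
    ((lower.and optTime_le).mono fun α h => h.1.trans h.2) upper
  have opt_asymp := AnomalyID.asympEquiv_abs_log_div_of_bounds hV lower fun V' hV' =>
    (upper V' hV').imp fun C hC => (optTime_le.and hC).mono fun α h => h.1.trans h.2
  exact ⟨admissible,
    si_asymp.div_of_common (AnomalyID.eventually_abs_log_div_pos hV) opt_asymp, opt_asymp⟩

theorem mainTheorem1 {M : ℕ} {S Ω : Type*} [MeasurableSpace S] [MeasurableSpace Ω]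
    (𝓜 : AnomalyID.Model M S Ω)
    (k : ℕ) (hk : 1 ≤ k) (hkM : k ≤ M)
    (K : ℝ) (hK : 0 < K) (hKM : K ≤ M)
    (A : Finset (Fin M))
    (R : ℕ → Ω → Finset (Fin M)) (hR : 𝓜.IsSamplingRule R)
    (hsamp : ∀ᶠ α in 𝓝[>] (0 : ℝ),
      𝓜.SamplingConstraint K (𝓜.siPolicy R k (AnomalyID.threshold M k α)))
    (c' : Fin M → ℝ) (hc' : AnomalyID.IsMinNormMaximizer k K (𝓜.F A) c')
    (σ : Equiv.Perm (Fin M)) (hσ : Monotone (𝓜.info A ∘ σ))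
    (cstar : Fin M → ℝ) (hcstar : ∀ i, cstar (σ i) = c' i)
    (hfreq : ∀ i, ∀ ε > 0,
      Summable fun n : ℕ => (𝓜.P A).real {ω | AnomalyID.freq R i (n + 1) ω < cstar i - ε}) :
    (∀ᶠ α in 𝓝[>] (0 : ℝ),
      𝓜.siPolicy R k (AnomalyID.threshold M k α) ∈ 𝓜.policyClass α k K) ∧
    AnomalyID.AsympEquiv
      (fun α => 𝓜.expT A (𝓜.siTime R k (AnomalyID.threshold M k α)))
      (fun α => 𝓜.optTime A α k K) ∧
    AnomalyID.AsympEquiv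
      (fun α => 𝓜.optTime A α k K)
      (fun α => ENNReal.ofReal (|Real.log α| / AnomalyID.optValue k K (𝓜.F A))) := by
  rw [AnomalyID.Model.optValue_F]
  exact mainTheorem1_general 𝓜 k hk hkM K hK A R hR hsamp cstar
    (AnomalyID.Model.isMaximizer_info_of_isMaximizer_F hσ hc'.1 hcstar) hfreq
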